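/- For an integer $N \ge 3$ let $\mathbb{Z}_N \times \mathbb{Z}$ be the cylinder graph, let $R_k = \{(x,y) : y \le k\}$, and let $\Omega$ be the (countable) set of all $A = R_0 \cup F$ with $F \subset \mathbb{Z}_N \times \mathbb{Z}$ finite. For $A \in \Omega$ let $h(A) = \max\{y : (x,y) \in A \text{ for some } x\}$ be its height, let $k_A = \max\{k \ge 0 : R_k \subseteq A\}$, and let $\mathcal{S}(A) = \{(x, y - k_A) : (x,y) \in A\}$ be its downshift. Shifted IDLA is the Markov chain on $\Omega$ that moves from $A$ to $\mathcal{S}(A \cup \{Z\})$, where $Z$ is the first site outside $A$ visited by a simple random walk on $\mathbb{Z}_N \times \mathbb{Z}$ started from a uniformly random site of level $0$, independent of the past. Then there is an integer $N_0$ such that for every $N \ge N_0$ Shifted IDLA has a unique stationary probability distribution $\mu_N$, and $$ \mu_N\big( \{ A \in \Omega : h(A) > N^8 \} \big) \le 2 e^{-N/2} . $$ -/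

import Mathlib

open MeasureTheory ProbabilityTheory Set

noncomputable section

namespace ShiftedIDLA

/-- The vertices of the cylinder graph `ℤ_N × ℤ`: horizontal coordinate, vertical coordinate. -/
abbrev Site (N : ℕ) : Type := ZMod N × ℤ

/-- The infinite rectangle `R_k = {(x, y) : y ≤ k}`. -/
def rect (N : ℕ) (k : ℤ) : Set (Site N) := {p | p.2 ≤ k}

/-- The configuration space `Ω` : sets of the form `R_0 ∪ F` with `F` finite. -/
@[ext]
structure Cluster (N : ℕ) where
  carrier : Set (Site N)
  eq_union : ∃ F : Set (Site N), F.Finite ∧ carrier = rect N 0 ∪ F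

/-- `Ω` is a countable set; every subset is an event. -/
instance (N : ℕ) : MeasurableSpace (Cluster N) := ⊤

instance (N : ℕ) : DiscreteMeasurableSpace (Cluster N) := ⟨fun _ => trivial⟩

/-- The height `h(A) = max {y : (x, y) ∈ A for some x}`. -/
def height {N : ℕ} (A : Cluster N) : ℤ := sSup {y : ℤ | ∃ x : ZMod N, (x, y) ∈ A.carrier}

/-! ### Simple random walk on the cylinder, released uniformly on level `0` -/

/-- The four unit steps of the cylinder graph. -/
def dir (N : ℕ) : Fin 4 → Site N := ![(1, 0), (-1, 0), (0, 1), (0, -1)]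

/-- The randomness of one particle: a starting point on level `0` and an infinite list of steps. -/
abbrev Particle (N : ℕ) : Type := ZMod N × (ℕ → Fin 4)

/-- The starting point is uniform, the steps are uniform on the four directions,
and all of these are independent. -/
def particleLaw (N : ℕ) [NeZero N] : Measure (Particle N) :=
  (PMF.uniformOfFintype (ZMod N)).toMeasure.prod
    (Measure.infinitePi fun _ : ℕ => (PMF.uniformOfFintype (Fin 4)).toMeasure)

/-- Position of the particle after `n` steps. -/
def walk {N : ℕ} (ω : Particle N) (n : ℕ) : Site N :=
  (ω.1, 0) + ∑ i ∈ Finset.range n, dir N (ω.2 i)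

/-- The first time that the particle is at an unoccupied site (finite almost surely; `0` on the
null event that the particle never leaves `A`). -/
def exitTime {N : ℕ} (A : Set (Site N)) (ω : Particle N) : ℕ := sInf {n | walk ω n ∉ A}

/-- The site at which the particle exits from `A`. -/
def exitSite {N : ℕ} (A : Set (Site N)) (ω : Particle N) : Site N := walk ω (exitTime A ω)

/-! ### The IDLA chain and the shifted chain -/

/-- The cluster `A ∪ {z}`. -/
def Cluster.insert {N : ℕ} (A : Cluster N) (z : Site N) : Cluster N where
  carrier := A.carrier ∪ {z}
  eq_union := by
    obtain ⟨F, hF, h⟩ := A.eq_union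
    exact ⟨F ∪ {z}, hF.union (finite_singleton z), by rw [h, union_assoc]⟩

/-- `k_A = max {k ≥ 0 : R_k ⊆ A}`. -/
def fillLevel {N : ℕ} (A : Cluster N) : ℕ := sSup {k : ℕ | rect N k ⊆ A.carrier}

lemma rect_fillLevel_subset {N : ℕ} (A : Cluster N) : rect N (fillLevel A) ⊆ A.carrier := by
  have h0 : (0 : ℕ) ∈ {k : ℕ | rect N k ⊆ A.carrier} := by
    obtain ⟨F, _, h⟩ := A.eq_union
    simp [h]
  by_cases hb : BddAbove {k : ℕ | rect N k ⊆ A.carrier}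
  · exact Nat.sSup_mem ⟨0, h0⟩ hb
  · have : fillLevel A = 0 := Nat.sSup_of_not_bddAbove hb
    rw [this]
    exact h0

/-- The downshift `S(A) = {(x, y - k_A) : (x, y) ∈ A}`. -/
def downshift {N : ℕ} (A : Cluster N) : Cluster N where
  carrier := (fun p : Site N => (p.1, p.2 - (fillLevel A : ℤ))) '' A.carrier
  eq_union := by
    obtain ⟨F, hF, h⟩ := A.eq_union
    refine ⟨(fun p : Site N => (p.1, p.2 - (fillLevel A : ℤ))) '' F, hF.image _, ?_⟩
    apply Subset.antisymm
    · rintro _ ⟨p, hp, rfl⟩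
      rw [h] at hp
      rcases hp with hp | hp
      · left
        simp only [rect, mem_ofPred_eq] at hp ⊢
        omega
      · exact Or.inr ⟨p, hp, rfl⟩
    · rintro q (hq | ⟨p, hp, rfl⟩)
      · refine ⟨(q.1, q.2 + (fillLevel A : ℤ)), rect_fillLevel_subset A ?_, by simp⟩
        simp only [rect, mem_ofPred_eq] at hq ⊢
        omega
      · exact ⟨p, by rw [h]; exact Or.inr hp, rfl⟩

/-- One step of IDLA: from `A`, the next cluster is `A ∪ {Z}`, with `Z` the exit location from `A`
of a simple random walk started uniformly on level `0`. -/
def idlaKernel (N : ℕ) [NeZero N] : Kernel (Cluster N) (Cluster N) where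
  toFun A := (particleLaw N).map fun ω => A.insert (exitSite A.carrier ω)
  measurable' := Measurable.of_discrete

/-- One step of Shifted IDLA: an IDLA step followed by the downshift. -/
def shiftedKernel (N : ℕ) [NeZero N] : Kernel (Cluster N) (Cluster N) :=
  (idlaKernel N).map downshift

/-- `μ` is a stationary distribution of the Shifted IDLA Markov chain. -/
def IsStationary (N : ℕ) [NeZero N] (μ : Measure (Cluster N)) : Prop :=
  IsProbabilityMeasure μ ∧ (shiftedKernel N).Invariant μ

/-! ### The transition laws are probability measures -/

lemma measurable_walk {N : ℕ} [NeZero N] (n : ℕ) : Measurable fun ω : Particle N => walk ω n := by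
  have hd : ∀ i : ℕ, Measurable fun ω : Particle N => dir N (ω.2 i) := fun i =>
    (Measurable.of_discrete (f := dir N)).comp ((measurable_pi_apply i).comp measurable_snd)
  have hs : Measurable fun ω : Particle N => ((ω.1, 0) : Site N) :=
    measurable_fst.prodMk measurable_const
  unfold walk
  induction n with
  | zero => simpa using hs
  | succ n ih =>
    simp only [Finset.sum_range_succ, ← add_assoc]
    exact (Measurable.of_discrete (f := fun p : Site N × Site N => p.1 + p.2)).comp
      (ih.prodMk (hd n))

lemma measurable_exitSite {N : ℕ} [NeZero N] (A : Set (Site N)) : Measurable (exitSite A) := by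
  have ht : Measurable (exitTime (N := N) A) := by
    have hm : ∀ n, MeasurableSet {ω : Particle N | walk ω n ∉ A} := fun n =>
      (measurable_walk n) (MeasurableSet.of_discrete (s := Aᶜ))
    have hE : ∀ n, {ω : Particle N | exitTime A ω = n} =
        {ω | walk ω n ∉ A ∧ ∀ m < n, ¬ walk ω m ∉ A} ∪ {ω | n = 0 ∧ ∀ m, ¬ walk ω m ∉ A} := by
      intro n
      ext ω
      by_cases h : ∃ m, walk ω m ∉ A
      · have hn : ¬ ∀ m, ¬ walk ω m ∉ A := fun h' => h.elim h'
        have hmem : walk ω (exitTime A ω) ∉ A := Nat.sInf_mem (s := {m | walk ω m ∉ A}) h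
        have hlt : ∀ m < exitTime A ω, ¬ walk ω m ∉ A := fun m hm' =>
          Nat.notMem_of_lt_sInf (s := {m | walk ω m ∉ A}) hm'
        simp only [mem_union, mem_ofPred_eq, hn, and_false, or_false]
        constructor
        · rintro rfl
          exact ⟨hmem, hlt⟩
        · rintro ⟨h1, h2⟩
          rcases lt_trichotomy (exitTime A ω) n with h3 | h3 | h3
          · exact absurd hmem (h2 _ h3)
          · exact h3
          · exact absurd h1 (hlt _ h3)
      · have hf : exitTime A ω = 0 := by
          have : {m | walk ω m ∉ A} = ∅ := eq_empty_of_forall_notMem fun m hm => h ⟨m, hm⟩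
          simp [exitTime, this]
        have hn : ∀ m, ¬ walk ω m ∉ A := fun m hm => h ⟨m, hm⟩
        simp only [mem_union, mem_ofPred_eq, hf, hn n, false_and, false_or]
        exact ⟨fun h => ⟨h.symm, hn⟩, fun h => h.1.symm⟩
    refine measurable_to_countable' fun n => ?_
    change MeasurableSet {ω : Particle N | exitTime A ω = n}
    rw [hE n]
    refine MeasurableSet.union ((hm n).inter ?_) (MeasurableSet.inter (.const _) ?_)
    · exact MeasurableSet.iInter (fun m => MeasurableSet.iInter fun _ : m < n => (hm m).compl)
        |>.congr (by ext; simp; rfl)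
    · exact MeasurableSet.iInter (fun m => (hm m).compl) |>.congr (by ext; simp; rfl)
  exact measurable_from_prod_countable_left (f := fun p : Particle N × ℕ => walk p.1 p.2)
    (fun n => measurable_walk n) |>.comp (measurable_id.prodMk ht)

instance (N : ℕ) [NeZero N] : IsProbabilityMeasure (particleLaw N) := by
  unfold particleLaw; infer_instance

instance (N : ℕ) [NeZero N] : IsMarkovKernel (shiftedKernel N) := by
  have : IsMarkovKernel (idlaKernel N) := ⟨fun A =>
    Measure.isProbabilityMeasure_map
      ((Measurable.of_discrete (f := A.insert)).comp (measurable_exitSite _)).aemeasurable⟩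
  exact Kernel.IsMarkovKernel.map _ Measurable.of_discrete

end ShiftedIDLA

end

noncomputable section

namespace ShiftedIDLA

/-! The proof is a Foster–Lyapunov argument for `exp (energy A)`, where `energy A` is the height
plus `1 / N` times the number of vacant sites up to the height. A particle that settles at or below
the height fills a vacancy and lowers the energy by at least `1 / N`. Otherwise the height rises by
at most one and at most `N` vacancies appear, so the energy rises by at most 2. Downshifting keeps
the vacancies and never raises the height.

It remains to see that settling above a tall cluster is unlikely. A downshifted cluster has a hole
on level 1. The potential kernel of the cylinder with its pole there is nonnegative, harmonic on the
cluster, at most `1 + 2 * N ^ 2` on level 0 and at least `h` on level `h + 1`. By the maximal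
inequality the probability is at most `(1 + 2 * N ^ 2) / h` (`measure_exit_above_le`). This forces
the Lyapunov function to contract by `1 - 1 / (4 * N)` in mean once `h ≥ N ^ 7`; at smaller heights
its next value is at most `exp (2 * N ^ 7 + 2)` (`lintegral_lyapunov_le`).

Drift and finite sublevel sets give a stationary law as a limit of Cesàro means
(`exists_invariant`). Uniqueness holds because filling level-1 holes one at a time leads from any
downshifted cluster to the flat one, so every nonzero finite invariant measure charges `flat N`
(`eq_of_invariant`, `eq_zero_of_flat`). Finally, `lintegral_le_of_drift` bounds the stationary mean
of the Lyapunov function by `4 * N * exp (2 * N ^ 7 + 2)`, and Markov's inequality at `exp (N ^ 8)`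
leaves ample room. -/

/-! ### Walks stopped on leaving a set, and supermartingale bounds -/

/-- The law of the sequence of steps of a particle. -/
def stepLaw : Measure (ℕ → Fin 4) :=
  Measure.infinitePi fun _ : ℕ => (PMF.uniformOfFintype (Fin 4)).toMeasure

instance : IsProbabilityMeasure stepLaw := by
  unfold stepLaw; infer_instance

open Classical in
/-- The walk started at `p` with steps `s`, frozen when it leaves `A`. -/
def stoppedWalk {N : ℕ} (A : Set (Site N)) (p : Site N) (s : ℕ → Fin 4) : ℕ → Site N
  | 0 => p
  | n + 1 =>
    if stoppedWalk A p s n ∈ A then stoppedWalk A p s n + dir N (s n) else stoppedWalk A p s n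

lemma stoppedWalk_congr {N : ℕ} (A : Set (Site N)) (p : Site N) {s t : ℕ → Fin 4} {n : ℕ}
    (h : ∀ i < n, s i = t i) : stoppedWalk A p s n = stoppedWalk A p t n := by
  induction n with
  | zero => rfl
  | succ n ih =>
    simp only [stoppedWalk]
    rw [ih fun i hi => h i (by omega), h n (by omega)]

lemma exists_stoppedWalk_eq {N : ℕ} (A : Set (Site N)) (p : Site N) (n : ℕ) :
    ∃ g : (Finset.range n → Fin 4) → Site N, ∀ s, stoppedWalk A p s n = g fun i => s i := by
  refine ⟨fun r => stoppedWalk A p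
    (fun i => if h : i ∈ Finset.range n then r ⟨i, h⟩ else 0) n, fun s => ?_⟩
  refine stoppedWalk_congr A p fun i hi => ?_
  simp [hi]

lemma measurable_stoppedWalk {N : ℕ} (A : Set (Site N)) (p : Site N) (n : ℕ) :
    Measurable fun s => stoppedWalk A p s n := by
  obtain ⟨g, hg⟩ := exists_stoppedWalk_eq A p n
  simp only [hg]
  exact (Measurable.of_discrete (f := g)).comp
    (measurable_pi_lambda _ fun i => measurable_pi_apply _)

/-- The stopped position at time `n` is a function of the steps before `n` only. -/
lemma indepFun_stoppedWalk {N : ℕ} (A : Set (Site N)) (p : Site N) (n : ℕ) :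
    IndepFun (fun s => stoppedWalk A p s n) (fun s : ℕ → Fin 4 => s n) stepLaw := by
  obtain ⟨g, hg⟩ := exists_stoppedWalk_eq A p n
  have hi : iIndepFun (fun (i : ℕ) (s : ℕ → Fin 4) => s i) stepLaw :=
    iIndepFun_infinitePi (X := fun _ x => x) fun _ => measurable_id
  have h := hi.indepFun_finset (Finset.range n) {n} (by simp) fun i => measurable_pi_apply i
  have h2 := h.comp (Measurable.of_discrete (f := g))
    (measurable_pi_apply (⟨n, by simp⟩ : ({n} : Finset ℕ)))
  convert h2 using 1
  · funext s
    exact hg s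
  · rfl

lemma lintegral_step (f : Fin 4 → ENNReal) :
    ∫⁻ d, f d ∂(PMF.uniformOfFintype (Fin 4)).toMeasure = (∑ d, f d) / 4 := by
  rw [lintegral_fintype, ENNReal.div_eq_inv_mul, Finset.mul_sum]
  refine Finset.sum_congr rfl fun d _ => ?_
  rw [PMF.toMeasure_apply_singleton _ _ (measurableSet_singleton d), mul_comm]
  simp

/-- The Markov property in the form used below: the fresh step is averaged out by independence. -/
lemma lintegral_stoppedWalk_step {N : ℕ} [NeZero N] (A : Set (Site N)) (p : Site N) (n : ℕ)
    (f : Site N → Fin 4 → ENNReal) :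
    ∫⁻ s, f (stoppedWalk A p s n) (s n) ∂stepLaw =
      ∫⁻ s, (∑ d, f (stoppedWalk A p s n) d) / 4 ∂stepLaw := by
  have hY := measurable_stoppedWalk A p n
  have hs : Measurable fun s : ℕ → Fin 4 => s n := measurable_pi_apply n
  have hf : Measurable fun q : Site N × Fin 4 => f q.1 q.2 := .of_discrete
  have h := (indepFun_iff_map_prod_eq_prod_map_map hY.aemeasurable hs.aemeasurable).1
    (indepFun_stoppedWalk A p n)
  rw [← lintegral_map (f := fun q : Site N × Fin 4 => f q.1 q.2) hf (hY.prodMk hs), h,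
    lintegral_prod _ hf.aemeasurable, lintegral_map .of_discrete hY]
  refine lintegral_congr fun s => ?_
  rw [← lintegral_step]
  congr 1
  exact Measure.infinitePi_map_eval _ n

open Classical in
/-- A function whose mean over the neighbours drops by at least `c` on `A` controls the walk
stopped on leaving `A`, together with the `c`-weighted occupation of `A`. -/
lemma lintegral_stoppedWalk_add_sum_le {N : ℕ} [NeZero N] {A : Set (Site N)}
    {u c : Site N → ENNReal} (huc : ∀ q ∈ A, (∑ d, u (q + dir N d)) / 4 + c q ≤ u q)
    (p : Site N) (n : ℕ) :
    ∫⁻ s, u (stoppedWalk A p s n) ∂stepLaw +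
      ∑ k ∈ Finset.range n, ∫⁻ s, A.indicator c (stoppedWalk A p s k) ∂stepLaw ≤ u p := by
  induction n with
  | zero => simp [stoppedWalk]
  | succ n ih =>
    refine le_trans ?_ ih
    rw [Finset.sum_range_succ, add_comm (∑ k ∈ _, _), ← add_assoc]
    gcongr
    have hm : Measurable fun s => A.indicator c (stoppedWalk A p s n) :=
      (Measurable.of_discrete (f := A.indicator c)).comp (measurable_stoppedWalk A p n)
    have h := lintegral_stoppedWalk_step A p n
      fun q d => u (if q ∈ A then q + dir N d else q)
    simp only [stoppedWalk]
    rw [h, ← lintegral_add_right _ hm]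
    refine lintegral_mono fun s => ?_
    by_cases hq : stoppedWalk A p s n ∈ A
    · simpa [hq] using huc _ hq
    · have h4 : (4 : ENNReal) * u (stoppedWalk A p s n) / 4 = u (stoppedWalk A p s n) := by
        rw [mul_comm, ENNReal.mul_div_cancel_right (by norm_num) (by norm_num)]
      simp [hq, h4]

/-- Maximal inequality for a nonnegative superharmonic function. -/
lemma measure_stoppedWalk_le {N : ℕ} [NeZero N] {A : Set (Site N)} {u : Site N → ENNReal}
    (hu : ∀ q ∈ A, (∑ d, u (q + dir N d)) / 4 ≤ u q) (p : Site N) (n : ℕ) {L : ENNReal}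
    (hL : L ≠ 0) (hL2 : L ≠ ⊤) :
    stepLaw {s | L ≤ u (stoppedWalk A p s n)} ≤ u p / L := by
  have h := lintegral_stoppedWalk_add_sum_le (A := A) (u := u) (c := 0) (by simpa using hu) p n
  have hm : Measurable fun s => u (stoppedWalk A p s n) :=
    (Measurable.of_discrete (f := u)).comp (measurable_stoppedWalk A p n)
  refine (meas_ge_le_lintegral_div hm.aemeasurable hL hL2).trans ?_
  gcongr
  exact le_trans (by simp) h

/-! ### The potential kernel of the cylinder -/

/-- The characters of `ℤ_N`: `cos (2 π k x / N)`. -/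
def cosChar {N : ℕ} [NeZero N] (k x : ZMod N) : ℝ := (ZMod.stdAddChar (k * x)).re

lemma cosChar_eq_cos {N : ℕ} [NeZero N] (k x : ZMod N) :
    cosChar k x = Real.cos (2 * Real.pi * (k * x).val / N) := by
  rw [cosChar, ZMod.stdAddChar_apply, ZMod.toCircle_apply, ← Complex.exp_ofReal_mul_I_re]
  congr 2
  push_cast
  ring

lemma abs_cosChar_le {N : ℕ} [NeZero N] (k x : ZMod N) : |cosChar k x| ≤ 1 := by
  rw [cosChar_eq_cos]; exact Real.abs_cos_le_one _

lemma cosChar_zero_left {N : ℕ} [NeZero N] (x : ZMod N) : cosChar 0 x = 1 := by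
  simp [cosChar]

lemma cosChar_add_sub {N : ℕ} [NeZero N] (k x : ZMod N) :
    cosChar k (x + 1) + cosChar k (x - 1) = 2 * cosChar k 1 * cosChar k x := by
  have hc : ZMod.stdAddChar (-(k * 1)) = (starRingEnd ℂ) (ZMod.stdAddChar (k * 1)) := by
    rw [ZMod.stdAddChar_apply, ZMod.stdAddChar_apply, AddChar.map_neg_eq_inv,
      Circle.coe_inv_eq_conj]
  simp only [cosChar]
  rw [mul_add, mul_sub, sub_eq_add_neg (k * x), AddChar.map_add_eq_mul, AddChar.map_add_eq_mul, hc]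
  simp only [Complex.mul_re, Complex.conj_re, Complex.conj_im]
  ring

lemma sum_cosChar {N : ℕ} [NeZero N] (x : ZMod N) (hx : x ≠ 0) : ∑ k, cosChar k x = 0 := by
  have h := AddChar.sum_mulShift x (ZMod.isPrimitive_stdAddChar N)
  rw [if_neg hx] at h
  simpa [cosChar] using congrArg Complex.re h

/-- Spectral gap: `cos (2θ) = 1 - 2 sin² θ` with `θ = π k / N`, and `sin θ ≥ 2 / N` by Jordan's
inequality, after reflecting `θ` to `π - θ` when `k` exceeds `N / 2`. -/
lemma cosChar_one_le {N : ℕ} [NeZero N] (k : ZMod N) (hk : k ≠ 0) :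
    cosChar k 1 ≤ 1 - 8 / (N : ℝ) ^ 2 := by
  have hN : (0 : ℝ) < N := by exact_mod_cast Nat.pos_of_ne_zero (NeZero.ne N)
  have hk1 : 1 ≤ k.val := Nat.one_le_iff_ne_zero.2 ((ZMod.val_ne_zero k).2 hk)
  have hk2 : k.val + 1 ≤ N := ZMod.val_lt k
  have h1 : (1 : ℝ) ≤ k.val := by exact_mod_cast hk1
  have h2 : (k.val : ℝ) + 1 ≤ N := by exact_mod_cast hk2
  have hpi := Real.pi_pos
  have hsin : 2 / (N : ℝ) ≤ Real.sin (Real.pi * k.val / N) := by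
    rcases le_total (2 * (k.val : ℝ)) N with h | h
    · have := Real.mul_le_sin (x := Real.pi * k.val / N) (by positivity)
        (by rw [div_le_div_iff₀ hN two_pos]; nlinarith)
      refine le_trans ?_ this
      rw [show 2 / Real.pi * (Real.pi * k.val / N) = 2 * k.val / N by field_simp]
      gcongr
      linarith
    · have := Real.mul_le_sin (x := Real.pi * (N - k.val) / N)
        (div_nonneg (mul_nonneg hpi.le (by linarith)) hN.le)
        (by rw [div_le_div_iff₀ hN two_pos]; nlinarith)
      rw [show Real.pi * (N - k.val) / N = Real.pi - Real.pi * k.val / N by field_simp,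
        Real.sin_pi_sub] at this
      refine le_trans ?_ this
      rw [show 2 / Real.pi * (Real.pi - Real.pi * k.val / N) = 2 * (N - k.val) / N by field_simp]
      gcongr
      linarith
  rw [cosChar_eq_cos, mul_one,
    show 2 * Real.pi * k.val / N = 2 * (Real.pi * k.val / N) by ring, Real.cos_two_mul,
    Real.cos_sq']
  have : (2 / (N : ℝ)) ^ 2 ≤ Real.sin (Real.pi * k.val / N) ^ 2 :=
    pow_le_pow_left₀ (by positivity) hsin 2
  have h8 : 8 / (N : ℝ) ^ 2 = 2 * (2 / (N : ℝ)) ^ 2 := by ring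
  linarith

/-- `sinh κ`, where `cosh κ + cos (2 π k / N) = 2`. -/
def modeSinh {N : ℕ} [NeZero N] (k : ZMod N) : ℝ := √((2 - cosChar k 1) ^ 2 - 1)

/-- `exp (-κ)`, where `cosh κ + cos (2 π k / N) = 2`. -/
def modeRate {N : ℕ} [NeZero N] (k : ZMod N) : ℝ := 2 - cosChar k 1 - modeSinh k

lemma modeSinh_sq {N : ℕ} [NeZero N] (k : ZMod N) :
    modeSinh k ^ 2 = (2 - cosChar k 1) ^ 2 - 1 := by
  have := (abs_le.1 (abs_cosChar_le k 1)).2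
  exact Real.sq_sqrt (by nlinarith)

/-- The quadratic equation that makes `cosChar k x * modeRate k ^ y` harmonic on either side of
level 0. -/
lemma modeRate_sq {N : ℕ} [NeZero N] (k : ZMod N) :
    modeRate k ^ 2 + 1 = 2 * (2 - cosChar k 1) * modeRate k := by
  have := modeSinh_sq k
  unfold modeRate
  linear_combination this

lemma le_modeSinh {N : ℕ} [NeZero N] (k : ZMod N) (hk : k ≠ 0) : 1 / (N : ℝ) ≤ modeSinh k := by
  have hN : (0 : ℝ) < N := by exact_mod_cast Nat.pos_of_ne_zero (NeZero.ne N)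
  have h := cosChar_one_le k hk
  apply Real.le_sqrt_of_sq_le
  have h8 : (0 : ℝ) < 1 / (N : ℝ) ^ 2 := by positivity
  have : 8 / (N : ℝ) ^ 2 = 8 * (1 / (N : ℝ) ^ 2) := by ring
  rw [div_pow, one_pow]
  nlinarith

lemma modeSinh_pos {N : ℕ} [NeZero N] (k : ZMod N) (hk : k ≠ 0) : 0 < modeSinh k := by
  have hN : (0 : ℝ) < N := by exact_mod_cast Nat.pos_of_ne_zero (NeZero.ne N)
  exact lt_of_lt_of_le (by positivity) (le_modeSinh k hk)

lemma modeRate_mem {N : ℕ} [NeZero N] (k : ZMod N) : 0 ≤ modeRate k ∧ modeRate k ≤ 1 := by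
  have hc := (abs_le.1 (abs_cosChar_le k 1)).2
  have hs := modeSinh_sq k
  have h0 : 0 ≤ modeSinh k := Real.sqrt_nonneg _
  unfold modeRate
  constructor <;> nlinarith

/-- The potential kernel of the cylinder, with its pole at the origin. -/
def potential {N : ℕ} [NeZero N] (p : Site N) : ℝ :=
  |(p.2 : ℝ)| + ∑ k ∈ Finset.univ.erase (0 : ZMod N),
    (1 - cosChar k p.1 * modeRate k ^ p.2.natAbs) / modeSinh k

lemma modeRate_pow_le_one {N : ℕ} [NeZero N] (k x : ZMod N) (n : ℕ) :
    |cosChar k x * modeRate k ^ n| ≤ 1 := by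
  obtain ⟨h0, h1⟩ := modeRate_mem k
  rw [abs_mul, abs_of_nonneg (pow_nonneg h0 n)]
  exact mul_le_one₀ (abs_cosChar_le k x) (pow_nonneg h0 n) (pow_le_one₀ h0 h1)

lemma abs_le_potential {N : ℕ} [NeZero N] (p : Site N) : |(p.2 : ℝ)| ≤ potential p := by
  refine le_add_of_nonneg_right (Finset.sum_nonneg fun k hk => ?_)
  have := (abs_le.1 (modeRate_pow_le_one k p.1 p.2.natAbs)).2
  exact div_nonneg (by linarith) (Real.sqrt_nonneg _)

/-- Each nonzero mode contributes at most `2 / modeSinh k ≤ 2 * N`, by the spectral gap. -/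
lemma potential_le {N : ℕ} [NeZero N] (p : Site N) :
    potential p ≤ |(p.2 : ℝ)| + 2 * (N : ℝ) ^ 2 := by
  have hN : (0 : ℝ) < N := by exact_mod_cast Nat.pos_of_ne_zero (NeZero.ne N)
  refine add_le_add_right ?_ _
  calc _ ≤ ∑ k ∈ Finset.univ.erase (0 : ZMod N), 2 * (N : ℝ) := by
        refine Finset.sum_le_sum fun k hk => ?_
        have h1 := (abs_le.1 (modeRate_pow_le_one k p.1 p.2.natAbs)).1
        have h2 := le_modeSinh k (Finset.ne_of_mem_erase hk)
        rw [div_le_iff₀ (modeSinh_pos k (Finset.ne_of_mem_erase hk))]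
        have h3 : 1 ≤ N * modeSinh k := by
          rw [div_le_iff₀ hN] at h2; linarith
        linarith
    _ ≤ ∑ k : ZMod N, 2 * (N : ℝ) :=
        Finset.sum_le_sum_of_subset_of_nonneg (Finset.erase_subset _ _)
          fun _ _ _ => by positivity
    _ = 2 * (N : ℝ) ^ 2 := by simp [ZMod.card]; ring

/-- The defect of harmonicity of `y ↦ r ^ |y|`. -/
lemma pow_natAbs_add {r t : ℝ} (h : r ^ 2 + 1 = 2 * t * r) (y : ℤ) :
    r ^ (y + 1).natAbs + r ^ (y - 1).natAbs =
      2 * t * r ^ y.natAbs - if y = 0 then 2 * (t - r) else 0 := by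
  rcases lt_trichotomy y 0 with hy | rfl | hy
  · obtain ⟨m, rfl⟩ : ∃ m : ℕ, y = -(m + 1 : ℕ) := ⟨(-y - 1).toNat, by omega⟩
    rw [show (-((m + 1 : ℕ) : ℤ) + 1).natAbs = m by omega,
      show (-((m + 1 : ℕ) : ℤ) - 1).natAbs = m + 2 by omega,
      show (-((m + 1 : ℕ) : ℤ)).natAbs = m + 1 by omega, if_neg (by omega)]
    linear_combination r ^ m * h
  · simp; ring
  · obtain ⟨m, rfl⟩ : ∃ m : ℕ, y = (m + 1 : ℕ) := ⟨(y - 1).toNat, by omega⟩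
    rw [show (((m + 1 : ℕ) : ℤ) + 1).natAbs = m + 2 by omega,
      show (((m + 1 : ℕ) : ℤ) - 1).natAbs = m by omega,
      show (((m + 1 : ℕ) : ℤ)).natAbs = m + 1 by omega, if_neg (by omega)]
    linear_combination r ^ m * h

lemma abs_add_abs_sub (y : ℤ) :
    |((y + 1 : ℤ) : ℝ)| + |((y - 1 : ℤ) : ℝ)| = 2 * |(y : ℝ)| + if y = 0 then 2 else 0 := by
  have : |y + 1| + |y - 1| = 2 * |y| + if y = 0 then 2 else 0 := by
    rcases abs_cases (y + 1) with h1 | h1 <;> rcases abs_cases (y - 1) with h2 | h2 <;>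
      rcases abs_cases y with h3 | h3 <;> split_ifs <;> omega
  exact_mod_cast this

lemma sum_dir {N : ℕ} (f : Site N → ℝ) (p : Site N) :
    ∑ d, f (p + dir N d) =
      f (p.1 + 1, p.2) + f (p.1 - 1, p.2) + f (p.1, p.2 + 1) + f (p.1, p.2 - 1) := by
  obtain ⟨x, y⟩ := p
  simp [Fin.sum_univ_four, dir, sub_eq_add_neg]

/-- The potential kernel is harmonic away from the origin. -/
lemma sum_potential {N : ℕ} [NeZero N] (p : Site N) (hp : p ≠ 0) :
    ∑ d, potential (p + dir N d) = 4 * potential p := by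
  obtain ⟨x, y⟩ := p
  rw [sum_dir]
  simp only [potential]
  -- Each mode is harmonic off level 0; its defect there is free of `modeSinh k` because of the
  -- normalisation of the summand.
  have hmode : ∀ k ∈ Finset.univ.erase (0 : ZMod N),
      (1 - cosChar k (x + 1) * modeRate k ^ y.natAbs) / modeSinh k +
      (1 - cosChar k (x - 1) * modeRate k ^ y.natAbs) / modeSinh k +
      (1 - cosChar k x * modeRate k ^ (y + 1).natAbs) / modeSinh k +
      (1 - cosChar k x * modeRate k ^ (y - 1).natAbs) / modeSinh k =
      4 * ((1 - cosChar k x * modeRate k ^ y.natAbs) / modeSinh k) +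
        if y = 0 then 2 * cosChar k x else 0 := by
    intro k hk
    have hs := (modeSinh_pos k (Finset.ne_of_mem_erase hk)).ne'
    have h1 := cosChar_add_sub k x
    have h2 := pow_natAbs_add (modeRate_sq k) y
    have h3 : 2 - cosChar k 1 - modeRate k = modeSinh k := by unfold modeRate; ring
    rw [h3] at h2
    field_simp
    split_ifs at h2 ⊢ with hy
    · linear_combination (-modeRate k ^ y.natAbs) * h1 - cosChar k x * h2
    · linear_combination (-modeRate k ^ y.natAbs) * h1 - cosChar k x * h2
  have hsum := Finset.sum_congr rfl hmode
  simp only [Finset.sum_add_distrib, ← Finset.mul_sum] at hsum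
  have habs := abs_add_abs_sub y
  -- On level 0 the defect 2 of `|y|` plays the part of the missing mode `k = 0`, so orthogonality
  -- of characters cancels the total defect away from the pole.
  have hz : (∑ k ∈ Finset.univ.erase (0 : ZMod N), if y = 0 then 2 * cosChar k x else 0) +
      (if y = 0 then (2 : ℝ) else 0) = 0 := by
    split_ifs with hy
    · have hx : x ≠ 0 := by
        rintro rfl
        exact hp (by simp [hy])
      have := Finset.sum_erase_add Finset.univ (fun k => cosChar k x) (Finset.mem_univ 0)
      rw [sum_cosChar x hx, cosChar_zero_left] at this
      rw [← Finset.mul_sum]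
      linarith
    · simp
  linear_combination hsum + habs + hz

/-! ### Heights and vacancies of clusters -/

lemma mem_of_le_zero {N : ℕ} (A : Cluster N) {p : Site N} (hp : p.2 ≤ 0) : p ∈ A.carrier := by
  obtain ⟨F, -, h⟩ := A.eq_union
  rw [h]
  exact Or.inl hp

lemma isGreatest_height {N : ℕ} (A : Cluster N) :
    IsGreatest {y : ℤ | ∃ x : ZMod N, (x, y) ∈ A.carrier} (height A) := by
  have hne : {y : ℤ | ∃ x : ZMod N, (x, y) ∈ A.carrier}.Nonempty :=
    ⟨0, 0, mem_of_le_zero A le_rfl⟩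
  have hbdd : BddAbove {y : ℤ | ∃ x : ZMod N, (x, y) ∈ A.carrier} := by
    obtain ⟨F, hF, h⟩ := A.eq_union
    obtain ⟨b, hb⟩ := (hF.image Prod.snd).bddAbove
    refine ⟨max 0 b, ?_⟩
    rintro y ⟨x, hx⟩
    rw [h] at hx
    rcases hx with hx | hx
    · exact le_max_of_le_left hx
    · exact le_max_of_le_right (hb ⟨_, hx, rfl⟩)
  exact ⟨Int.csSup_mem hne hbdd, fun y hy => le_csSup hbdd hy⟩

lemma le_height {N : ℕ} {A : Cluster N} {p : Site N} (hp : p ∈ A.carrier) : p.2 ≤ height A :=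
  (isGreatest_height A).2 ⟨p.1, hp⟩

lemma height_nonneg {N : ℕ} (A : Cluster N) : 0 ≤ height A :=
  le_height (p := (0, 0)) (mem_of_le_zero A le_rfl)

lemma height_insert {N : ℕ} (A : Cluster N) (z : Site N) :
    height (A.insert z) = max (height A) z.2 := by
  refine IsGreatest.csSup_eq ⟨?_, ?_⟩
  · rcases le_total (height A) z.2 with h | h
    · exact ⟨z.1, by rw [max_eq_right h]; exact Or.inr rfl⟩
    · obtain ⟨x, hx⟩ := (isGreatest_height A).1
      exact ⟨x, by rw [max_eq_left h]; exact Or.inl hx⟩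
  · rintro y ⟨x, hx | hx⟩
    · exact le_max_of_le_left (le_height hx)
    · rw [mem_singleton_iff] at hx
      rw [← hx]
      exact le_max_right _ _

lemma le_height_of_rect_subset {N : ℕ} {A : Cluster N} {k : ℕ} (h : rect N k ⊆ A.carrier) :
    (k : ℤ) ≤ height A :=
  le_height (p := (0, (k : ℤ))) (h (le_refl (k : ℤ)))

lemma le_fillLevel {N : ℕ} {A : Cluster N} {k : ℕ} (h : rect N k ⊆ A.carrier) :
    k ≤ fillLevel A := by
  refine le_csSup ⟨(height A).toNat, fun m hm => ?_⟩ h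
  have := le_height_of_rect_subset hm
  omega

lemma exists_hole {N : ℕ} (A : Cluster N) (hA : fillLevel A = 0) :
    ∃ x : ZMod N, ((x, 1) : Site N) ∉ A.carrier := by
  by_contra! h
  have : rect N ((1 : ℕ) : ℤ) ⊆ A.carrier := by
    rintro ⟨x, y⟩ hp
    have hy : y ≤ 1 := hp
    rcases eq_or_lt_of_le hy with rfl | hy
    · exact h x
    · exact mem_of_le_zero A (by simpa using Int.lt_add_one_iff.1 hy)
  have := le_fillLevel this
  omega

lemma mem_downshift {N : ℕ} (A : Cluster N) (p : Site N) :
    p ∈ (downshift A).carrier ↔ (p.1, p.2 + (fillLevel A : ℤ)) ∈ A.carrier := by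
  constructor
  · rintro ⟨q, hq, rfl⟩
    simpa using hq
  · intro h
    exact ⟨_, h, by simp⟩

lemma fillLevel_downshift {N : ℕ} (A : Cluster N) : fillLevel (downshift A) = 0 := by
  have h := rect_fillLevel_subset (downshift A)
  have : rect N ((fillLevel (downshift A) + fillLevel A : ℕ) : ℤ) ⊆ A.carrier := by
    intro p hp
    have hp2 : p.2 ≤ ((fillLevel (downshift A) + fillLevel A : ℕ) : ℤ) := hp
    have := (mem_downshift A (p.1, p.2 - fillLevel A)).1 (h (by
      simp only [rect, mem_ofPred_eq]; omega))
    simpa using this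
  have := le_fillLevel this
  omega

lemma height_downshift {N : ℕ} (A : Cluster N) :
    height (downshift A) = height A - fillLevel A := by
  refine IsGreatest.csSup_eq ⟨?_, ?_⟩
  · obtain ⟨x, hx⟩ := (isGreatest_height A).1
    exact ⟨x, (mem_downshift A _).2 (by simpa using hx)⟩
  · rintro y ⟨x, hx⟩
    have := le_height ((mem_downshift A _).1 hx)
    simp only at this
    omega

/-- The empty sites at levels up to the height of the cluster. -/
def vacant {N : ℕ} (A : Cluster N) : Set (Site N) := {p | p.2 ≤ height A ∧ p ∉ A.carrier}

/-- The number of empty sites at levels up to the height of the cluster. -/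
def vacancy {N : ℕ} (A : Cluster N) : ℕ := (vacant A).ncard

lemma vacant_subset {N : ℕ} (A : Cluster N) : vacant A ⊆ univ ×ˢ Ioc 0 (height A) := by
  rintro p ⟨h1, h2⟩
  refine ⟨mem_univ _, ?_, h1⟩
  by_contra h
  exact h2 (mem_of_le_zero A (not_lt.1 h))

lemma finite_vacant {N : ℕ} [NeZero N] (A : Cluster N) : (vacant A).Finite :=
  (finite_univ.prod (finite_Ioc _ _)).subset (vacant_subset A)

lemma vacancy_le {N : ℕ} [NeZero N] (A : Cluster N) : (vacancy A : ℤ) ≤ N * height A := by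
  have h := ncard_le_ncard (vacant_subset A) (finite_univ.prod (finite_Ioc _ _))
  rw [ncard_prod, ncard_univ, Nat.card_zmod, ← Finset.coe_Ioc, ncard_coe_finset,
    Int.card_Ioc] at h
  have h0 := height_nonneg A
  calc (vacancy A : ℤ) ≤ ((N * (height A - 0).toNat : ℕ) : ℤ) := by exact_mod_cast h
    _ = N * height A := by push_cast; rw [Int.toNat_of_nonneg (by omega)]; ring

lemma vacancy_downshift {N : ℕ} (A : Cluster N) : vacancy (downshift A) = vacancy A := by
  have hinj : Function.Injective fun p : Site N => ((p.1, p.2 + (fillLevel A : ℤ)) : Site N) := by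
    rintro ⟨x, y⟩ ⟨x', y'⟩ h
    simpa using h
  rw [vacancy, ← ncard_image_of_injective _ hinj, vacancy]
  congr 1
  ext p
  constructor
  · rintro ⟨q, ⟨h1, h2⟩, rfl⟩
    rw [height_downshift] at h1
    exact ⟨by simp only; omega, fun h => h2 ((mem_downshift A q).2 h)⟩
  · rintro ⟨h1, h2⟩
    refine ⟨(p.1, p.2 - fillLevel A), ⟨?_, fun h => h2 ?_⟩, by simp⟩
    · rw [height_downshift]
      simp only
      omega
    · simpa using (mem_downshift A _).1 h

lemma vacancy_insert_of_le {N : ℕ} [NeZero N] (A : Cluster N) {z : Site N} (hz : z ∉ A.carrier)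
    (hle : z.2 ≤ height A) : vacancy (A.insert z) + 1 = vacancy A := by
  have : vacant (A.insert z) = vacant A \ {z} := by
    ext p
    simp only [vacant, height_insert, max_eq_left hle, mem_ofPred_eq, mem_sdiff]
    simp only [Cluster.insert, mem_union, not_or, and_assoc]
  rw [vacancy, this]
  exact ncard_sdiff_singleton_add_one ⟨hle, hz⟩ (finite_vacant A)

/-- The height grows by at most one level, which has `N` sites. -/
lemma vacancy_insert_le {N : ℕ} [NeZero N] (A : Cluster N) {z : Site N}
    (hle : z.2 ≤ height A + 1) : vacancy (A.insert z) ≤ vacancy A + N := by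
  have hsub : vacant (A.insert z) ⊆ vacant A ∪ univ ×ˢ {height A + 1} := by
    rintro p ⟨h1, h2⟩
    rw [height_insert] at h1
    by_cases h : p.2 ≤ height A
    · exact Or.inl ⟨h, fun h' => h2 (Or.inl h')⟩
    · refine Or.inr ⟨mem_univ _, ?_⟩
      rw [mem_singleton_iff]
      omega
  have h := ncard_le_ncard hsub ((finite_vacant A).union (finite_univ.prod (finite_singleton _)))
  refine h.trans ((ncard_union_le _ _).trans ?_)
  rw [ncard_prod, ncard_univ, Nat.card_zmod, ncard_singleton, mul_one]
  rfl

/-- The flat cluster `R_0`. -/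
def flat (N : ℕ) : Cluster N := ⟨rect N 0, ∅, finite_empty, by simp⟩

lemma eq_flat {N : ℕ} [NeZero N] {A : Cluster N} (hA : fillLevel A = 0) (h : vacancy A = 0) :
    A = flat N := by
  have hv : vacant A = ∅ := (ncard_eq_zero (finite_vacant A)).1 h
  have hh : height A ≤ 0 := by
    by_contra! hlt
    obtain ⟨x, hx⟩ := exists_hole A hA
    have : ((x, 1) : Site N) ∈ vacant A := ⟨hlt, hx⟩
    simp [hv] at this
  ext p
  exact ⟨fun hp => (le_height hp).trans hh, fun hp => mem_of_le_zero A hp⟩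

instance {N : ℕ} [NeZero N] : Countable (Cluster N) := by
  let f : Finset (Site N) → Cluster N := fun F => ⟨rect N 0 ∪ F, F, F.finite_toSet, rfl⟩
  refine Function.Surjective.countable (f := f) fun A => ?_
  obtain ⟨F, hF, h⟩ := A.eq_union
  exact ⟨hF.toFinset, by ext p; simp [f, h]⟩

/-- A cluster is determined by its trace on the finite box of levels `1, …, m`. -/
lemma finite_height_le (N : ℕ) [NeZero N] (m : ℤ) : {A : Cluster N | height A ≤ m}.Finite := by
  have hfin : (univ ×ˢ Ioc 0 m : Set (Site N)).Finite := finite_univ.prod (finite_Ioc _ _)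
  refine Finite.of_finite_image (f := fun A => A.carrier ∩ univ ×ˢ Ioc 0 m)
    (hfin.finite_subsets.subset ?_) ?_
  · rintro _ ⟨A, -, rfl⟩
    exact inter_subset_right
  · intro A hA B hB hAB
    have key : ∀ {A B : Cluster N}, height A ≤ m →
        A.carrier ∩ univ ×ˢ Ioc 0 m = B.carrier ∩ univ ×ˢ Ioc 0 m → A.carrier ⊆ B.carrier := by
      intro A B hA h p hp
      rcases le_or_gt p.2 0 with h0 | h0
      · exact mem_of_le_zero B h0
      · have : p ∈ A.carrier ∩ univ ×ˢ Ioc 0 m := ⟨hp, mem_univ _, h0, (le_height hp).trans hA⟩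
        rw [h] at this
        exact this.1
    exact Cluster.ext (Subset.antisymm (key hA hAB) (key hB hAB.symm))

/-! ### Markov chains on a countable state space -/

section Chain

open Filter Topology

variable {α : Type*} [MeasurableSpace α]

lemma bind_kernel_apply [DiscreteMeasurableSpace α] (μ : Measure α) (κ : Kernel α α) (s : Set α) :
    μ.bind κ s = ∫⁻ x, κ x s ∂μ :=
  Measure.bind_apply (.of_discrete) κ.aemeasurable

/-- Foster's bound: a stationary distribution integrates a Lyapunov function. -/
lemma lintegral_le_of_drift [DiscreteMeasurableSpace α] {κ : Kernel α α} [IsMarkovKernel κ] {μ : Measure α}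
    [IsProbabilityMeasure μ] (hμ : κ.Invariant μ) {V : α → ENNReal} (hV : ∀ᵐ x ∂μ, V x ≠ ⊤)
    {r b : ENNReal} (hr : r ≤ 1) (hb : b ≠ ⊤) (hdrift : ∀ x, ∫⁻ y, V y ∂κ x ≤ r * V x + b) :
    (1 - r) * ∫⁻ x, V x ∂μ ≤ b := by
  -- Integrability of `V` is not known in advance, so invariance is applied to the truncations `min
  -- V M`. Each `g M` has integral at most `b`, and eventually `g M x` is at least `(1 - r) * V x`;
  -- Fatou's lemma concludes.
  let g : ℕ → α → ENNReal := fun M x => (min (V x) M + b) - min (r * V x + b) M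
  have hle : ∀ (M : ℕ) x, min (r * V x + b) M ≤ min (V x) M + b := by
    intro M x
    have h1 : r * V x ≤ V x := mul_le_of_le_one_left zero_le hr
    rcases le_total (V x) M with h | h
    · rw [min_eq_left h]
      exact (min_le_left _ _).trans (by gcongr)
    · rw [min_eq_right h]
      exact (min_le_right _ _).trans le_self_add
  have hg : ∀ M : ℕ, ∫⁻ x, g M x ∂μ ≤ b := by
    intro M
    have hfin : ∫⁻ x, min (r * V x + b) M ∂μ ≠ ⊤ := by
      refine ne_top_of_le_ne_top (ENNReal.natCast_ne_top M) ?_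
      calc _ ≤ ∫⁻ x, (M : ENNReal) ∂μ := lintegral_mono fun x => min_le_right _ _
        _ = M := by simp
    have hinv : ∫⁻ x, min (V x) M ∂μ ≤ ∫⁻ x, min (r * V x + b) M ∂μ := by
      conv_lhs => rw [← hμ.def]
      rw [Measure.lintegral_bind κ.aemeasurable Measurable.of_discrete.aemeasurable]
      refine lintegral_mono fun x => le_min ?_ ?_
      · exact (lintegral_mono fun y => min_le_left _ _).trans (hdrift x)
      · calc _ ≤ ∫⁻ y, (M : ENNReal) ∂κ x := lintegral_mono fun x => min_le_right _ _
          _ = M := by simp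
    rw [lintegral_sub .of_discrete hfin (.of_forall (hle M)),
      lintegral_add_right _ measurable_const, lintegral_const, measure_univ, mul_one]
    rw [tsub_le_iff_left]
    gcongr
  have hfatou := lintegral_liminf_le (μ := μ) (u := atTop) (f := g) fun _ => .of_discrete
  rw [← lintegral_const_mul _ .of_discrete]
  calc ∫⁻ x, (1 - r) * V x ∂μ ≤ ∫⁻ x, liminf (fun n => g n x) atTop ∂μ := by
        refine lintegral_mono_ae ?_
        filter_upwards [hV] with x hx
        refine le_liminf_of_le (by isBoundedDefault) ?_
        have hfin : r * V x + b ≠ ⊤ :=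
          ENNReal.add_ne_top.2 ⟨ENNReal.mul_ne_top (ne_top_of_le_ne_top ENNReal.one_ne_top hr) hx, hb⟩
        obtain ⟨n₁, hn₁⟩ := ENNReal.exists_nat_gt hx
        obtain ⟨n₂, hn₂⟩ := ENNReal.exists_nat_gt hfin
        filter_upwards [eventually_ge_atTop n₁, eventually_ge_atTop n₂] with n h1 h2
        have h1' : V x ≤ n := hn₁.le.trans (by exact_mod_cast h1)
        have h2' : r * V x + b ≤ n := hn₂.le.trans (by exact_mod_cast h2)
        simp only [g, min_eq_left h1', min_eq_left h2']
        refine ENNReal.le_sub_of_add_le_right hfin ?_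
        rw [← add_assoc, ← add_mul, tsub_add_cancel_of_le hr, one_mul]
    _ ≤ _ := hfatou
    _ ≤ b := (liminf_le_liminf (.of_forall hg)).trans (by simp)

/-- A Markov kernel preserves total mass, so a subinvariant finite measure cannot lose any. -/
lemma invariant_of_bind_le [DiscreteMeasurableSpace α] {κ : Kernel α α} [IsMarkovKernel κ] {μ : Measure α}
    [IsFiniteMeasure μ] (h : μ.bind κ ≤ μ) : κ.Invariant μ := by
  refine Measure.eq_of_le_of_measure_univ_eq h ?_
  simp [bind_kernel_apply]

lemma bind_kernel_mono [DiscreteMeasurableSpace α] {μ ν : Measure α} (κ : Kernel α α) (h : μ ≤ ν) :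
    μ.bind κ ≤ ν.bind κ := by
  refine Measure.le_iff.2 fun s _ => ?_
  rw [bind_kernel_apply, bind_kernel_apply]
  exact lintegral_mono' h le_rfl

lemma measure_le_of_singleton [Countable α] [DiscreteMeasurableSpace α] {μ ν : Measure α} (h : ∀ x, μ {x} ≤ ν {x}) : μ ≤ ν := by
  refine Measure.le_iff.2 fun s hs => ?_
  rw [← Measure.tsum_indicator_apply_singleton _ _ hs,
    ← Measure.tsum_indicator_apply_singleton _ _ hs]
  exact ENNReal.tsum_le_tsum fun x => indicator_le_indicator (h x)

/-- The measure with prescribed masses of points. -/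
def ofMass (f : α → ENNReal) : Measure α := Measure.sum fun x => f x • Measure.dirac x

lemma ofMass_singleton [DiscreteMeasurableSpace α] (f : α → ENNReal) (x : α) : ofMass f {x} = f x := by
  rw [ofMass, Measure.sum_apply _ (.of_discrete), tsum_eq_single x]
  · simp
  · intro y hy
    simp [hy]

lemma ofMass_univ [Countable α] [DiscreteMeasurableSpace α] (f : α → ENNReal) : ofMass f univ = ∑' x, f x := by
  rw [← Measure.tsum_indicator_apply_singleton _ _ .univ]
  simp [ofMass_singleton]

/-- A chain has at most one stationary distribution if some state is charged by every nonzero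
invariant measure. -/
lemma eq_of_invariant [Countable α] [DiscreteMeasurableSpace α] {κ : Kernel α α} [IsMarkovKernel κ] {o : α}
    (ho : ∀ η : Measure α, IsFiniteMeasure η → κ.Invariant η → η {o} = 0 → η = 0)
    {μ ν : Measure α} [IsProbabilityMeasure μ] [IsProbabilityMeasure ν] (hμ : κ.Invariant μ)
    (hν : κ.Invariant ν) : μ = ν := by
  wlog hle : μ {o} ≤ ν {o} generalizing μ ν
  · exact (this hν hμ (le_of_not_ge hle)).symm
  -- The pointwise minimum of two invariant measures is subinvariant, hence invariant, and so is `μ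
  -- - m`. The latter vanishes at `o`, so it is zero and `μ = m ≤ ν`.
  let m : Measure α := ofMass fun x => min (μ {x}) (ν {x})
  have hmμ : m ≤ μ := measure_le_of_singleton fun x => by simp [m, ofMass_singleton]
  have hmν : m ≤ ν := measure_le_of_singleton fun x => by simp [m, ofMass_singleton]
  have : IsFiniteMeasure m := isFiniteMeasure_of_le μ hmμ
  have hm : κ.Invariant m := by
    refine invariant_of_bind_le (measure_le_of_singleton fun x => ?_)
    have h1 := bind_kernel_mono κ hmμ {x}
    have h2 := bind_kernel_mono κ hmν {x}
    rw [hμ.def] at h1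
    rw [hν.def] at h2
    simp only [m, ofMass_singleton]
    exact le_min h1 h2
  have hsum : μ - m + m = μ := Measure.sub_add_cancel_of_le hmμ
  have hinv : κ.Invariant (μ - m) := by
    refine Measure.ext_of_singleton fun x => ?_
    have h := congrArg (fun η : Measure α => η.bind κ {x}) hsum
    simp only [bind_kernel_apply, lintegral_add_measure] at h
    rw [← bind_kernel_apply, ← bind_kernel_apply, ← bind_kernel_apply, hm.def, hμ.def] at h
    conv_rhs at h => rw [← hsum]
    rw [Measure.add_apply] at h
    exact (ENNReal.add_left_inj (measure_ne_top m {x})).1 h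
  have h0 : (μ - m) {o} = 0 := by
    have h := congrArg (fun η : Measure α => η {o}) hsum
    simp only [Measure.add_apply, m, ofMass_singleton, min_eq_left hle] at h
    exact (ENNReal.add_left_inj (measure_ne_top μ {o})).1 (by simpa using h)
  have hz := ho _ inferInstance hinv h0
  rw [hz, zero_add] at hsum
  rw [hsum] at hmν
  exact Measure.eq_of_le_of_measure_univ_eq hmν (by simp)

lemma charged_of_transition [DiscreteMeasurableSpace α] {κ : Kernel α α} {μ : Measure α} (hμ : κ.Invariant μ) {x y : α}
    (hx : μ {x} ≠ 0) (hxy : κ x {y} ≠ 0) : μ {y} ≠ 0 := by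
  intro h
  rw [← hμ.def, bind_kernel_apply, lintegral_eq_zero_iff .of_discrete] at h
  have : {x} ⊆ {x | ¬ κ x {y} = (0 : α → ENNReal) x} := by simpa using hxy
  exact hx (measure_mono_null this h)

/-- The law of the chain at time `n`. -/
def iterLaw (κ : Kernel α α) (o : α) : ℕ → Measure α
  | 0 => Measure.dirac o
  | n + 1 => (iterLaw κ o n).bind κ

lemma isProbabilityMeasure_iterLaw (κ : Kernel α α) [IsMarkovKernel κ] (o : α) (n : ℕ) :
    IsProbabilityMeasure (iterLaw κ o n) := by
  induction n with
  | zero => unfold iterLaw; infer_instance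
  | succ n ih => unfold iterLaw; infer_instance

lemma lintegral_iterLaw_le [DiscreteMeasurableSpace α] {κ : Kernel α α} [IsMarkovKernel κ] {o : α} {V : α → ENNReal}
    {r b C : ENNReal} (hdrift : ∀ x, ∫⁻ y, V y ∂κ x ≤ r * V x + b) (ho : V o ≤ C)
    (hC : r * C + b ≤ C) (n : ℕ) : ∫⁻ x, V x ∂iterLaw κ o n ≤ C := by
  induction n with
  | zero =>
    simpa [iterLaw] using ho
  | succ n ih =>
    have := isProbabilityMeasure_iterLaw κ o n
    rw [iterLaw, Measure.lintegral_bind κ.aemeasurable Measurable.of_discrete.aemeasurable]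
    calc _ ≤ ∫⁻ x, (r * V x + b) ∂iterLaw κ o n := lintegral_mono hdrift
      _ = r * ∫⁻ x, V x ∂iterLaw κ o n + b := by
        rw [lintegral_add_right _ measurable_const, lintegral_const_mul _ .of_discrete]
        simp
      _ ≤ r * C + b := by gcongr
      _ ≤ C := hC

/-- The mean of the laws of the chain at times `0, …, n - 1`. -/
def cesaroLaw (κ : Kernel α α) (o : α) (n : ℕ) : Measure α :=
  (n : ENNReal)⁻¹ • ∑ k ∈ Finset.range n, iterLaw κ o k

lemma lintegral_cesaroLaw (κ : Kernel α α) (o : α) (n : ℕ) (f : α → ENNReal) :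
    ∫⁻ x, f x ∂cesaroLaw κ o n =
      (n : ENNReal)⁻¹ * ∑ k ∈ Finset.range n, ∫⁻ x, f x ∂iterLaw κ o k := by
  rw [cesaroLaw, lintegral_smul_measure, lintegral_finsetSum_measure, smul_eq_mul]

lemma cesaroLaw_univ (κ : Kernel α α) [IsMarkovKernel κ] (o : α) {n : ℕ} (hn : n ≠ 0) :
    cesaroLaw κ o n univ = 1 := by
  have := isProbabilityMeasure_iterLaw κ o
  have h := lintegral_cesaroLaw κ o n fun _ => 1
  simp only [lintegral_const, measure_univ, one_mul, Finset.sum_const, Finset.card_range,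
    nsmul_eq_mul, mul_one] at h
  rw [h, ENNReal.inv_mul_cancel (by exact_mod_cast hn) (ENNReal.natCast_ne_top n)]

/-- Applying the kernel shifts the time window by one, which costs at most one term of weight `1 /
n`. -/
lemma bind_cesaroLaw_le [DiscreteMeasurableSpace α] (κ : Kernel α α) [IsMarkovKernel κ] (o : α) (n : ℕ) (s : Set α) :
    ∫⁻ x, κ x s ∂cesaroLaw κ o n ≤ cesaroLaw κ o n s + (n : ENNReal)⁻¹ := by
  have := isProbabilityMeasure_iterLaw κ o n
  have h : ∀ k, ∫⁻ x, κ x s ∂iterLaw κ o k = iterLaw κ o (k + 1) s := fun k =>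
    (bind_kernel_apply _ _ _).symm
  rw [lintegral_cesaroLaw]
  simp only [h]
  calc _ ≤ (n : ENNReal)⁻¹ * ∑ k ∈ Finset.range (n + 1), iterLaw κ o k s := by
        rw [Finset.sum_range_succ']
        gcongr
        exact le_self_add
    _ = cesaroLaw κ o n s + (n : ENNReal)⁻¹ * iterLaw κ o n s := by
        rw [Finset.sum_range_succ, mul_add]
        simp [cesaroLaw, Measure.finsetSum_apply]
    _ ≤ _ := by
        gcongr
        exact mul_le_of_le_one_right zero_le prob_le_one

/-- A chain with a Lyapunov function whose sublevel sets are finite has a stationary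
distribution. -/
lemma exists_invariant [Countable α] [DiscreteMeasurableSpace α] {κ : Kernel α α} [IsMarkovKernel κ] {o : α} {V : α → ENNReal}
    {r b C : ENNReal} (hdrift : ∀ x, ∫⁻ y, V y ∂κ x ≤ r * V x + b) (ho : V o ≤ C)
    (hC : r * C + b ≤ C) (hCtop : C ≠ ⊤) (hfin : ∀ M : ℕ, {x | V x < M}.Finite) :
    ∃ μ : Measure α, IsProbabilityMeasure μ ∧ κ.Invariant μ := by
  classical
  -- A limit along a free ultrafilter, available by compactness of `α → ENNReal`, replaces the
  -- extraction of a subsequence.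
  let U : Ultrafilter ℕ := hyperfilter ℕ
  have hU : (U : Filter ℕ) ≤ atTop := Nat.hyperfilter_le_atTop
  let a : ℕ → α → ENNReal := fun n x => cesaroLaw κ o n {x}
  obtain ⟨m, -, hm⟩ := isCompact_univ.ultrafilter_le_nhds (U.map a) (by simp)
  have hma : Tendsto a U (𝓝 m) := hm
  have hmx : ∀ x, Tendsto (fun n => cesaroLaw κ o n {x}) U (𝓝 (m x)) := fun x =>
    (tendsto_pi_nhds.1 hma) x
  have hF : ∀ F : Finset α, Tendsto (fun n => cesaroLaw κ o n F) U (𝓝 (∑ x ∈ F, m x)) := by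
    intro F
    have := tendsto_finsetSum F fun x _ => hmx x
    refine this.congr fun n => ?_
    exact sum_measure_singleton
  have hpos : ∀ᶠ n in (U : Filter ℕ), n ≠ 0 := hU (eventually_ne_atTop 0)
  have hle : ∑' x, m x ≤ 1 := by
    rw [ENNReal.tsum_eq_iSup_sum]
    refine iSup_le fun F => le_of_tendsto (hF F) ?_
    filter_upwards [hpos] with n hn
    exact (measure_mono (subset_univ _)).trans (cesaroLaw_univ κ o hn).le
  -- Tightness: by Markov's inequality all but `C / M` of each Cesàro mean lies on the finite set `V
  -- < M`, so no mass escapes in the limit.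
  have hge : 1 ≤ ∑' x, m x := by
    have key : ∀ M : ℕ, M ≠ 0 → 1 ≤ ∑' x, m x + C / M := by
      intro M hM
      have htail : ∀ n ≠ 0, 1 ≤ cesaroLaw κ o n (hfin M).toFinset + C / M := by
        intro n hn
        have hmark : cesaroLaw κ o n {x | (M : ENNReal) ≤ V x} ≤ C / M := by
          refine (meas_ge_le_lintegral_div Measurable.of_discrete.aemeasurable
            (by exact_mod_cast hM) (ENNReal.natCast_ne_top M)).trans ?_
          gcongr
          rw [lintegral_cesaroLaw]
          calc _ ≤ (n : ENNReal)⁻¹ * ∑ k ∈ Finset.range n, C := by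
                gcongr with k
                exact lintegral_iterLaw_le hdrift ho hC k
            _ = C := by
                rw [Finset.sum_const, Finset.card_range, nsmul_eq_mul, ← mul_assoc,
                  ENNReal.inv_mul_cancel (by exact_mod_cast hn) (ENNReal.natCast_ne_top n), one_mul]
        rw [← cesaroLaw_univ κ o hn]
        refine le_trans ?_ ((measure_union_le _ _).trans (add_le_add_right hmark _))
        refine measure_mono fun x _ => ?_
        simp only [Finite.coe_toFinset, mem_union, mem_ofPred_eq]
        exact lt_or_ge _ _
      have hlim := (hF (hfin M).toFinset).add_const (C / M)
      refine (ge_of_tendsto hlim ?_).trans (add_le_add_left (ENNReal.sum_le_tsum _) _)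
      filter_upwards [hpos] with n hn
      exact htail n hn
    have hlim : Tendsto (fun M : ℕ => ∑' x, m x + C / M) atTop (𝓝 (∑' x, m x + 0)) := by
      refine tendsto_const_nhds.add ?_
      have := ENNReal.Tendsto.const_mul ENNReal.tendsto_inv_nat_nhds_zero (Or.inr hCtop)
      simpa [div_eq_mul_inv] using this
    rw [add_zero] at hlim
    refine ge_of_tendsto hlim ?_
    filter_upwards [eventually_ne_atTop 0] with M hM using key M hM
  have hone : ofMass m univ = 1 := (ofMass_univ m).trans (le_antisymm hle hge)
  have : IsProbabilityMeasure (ofMass m) := ⟨hone⟩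
  refine ⟨ofMass m, this, invariant_of_bind_le (measure_le_of_singleton fun y => ?_)⟩
  rw [bind_kernel_apply, lintegral_countable', ofMass_singleton, ENNReal.tsum_eq_iSup_sum]
  simp only [ofMass_singleton]
  refine iSup_le fun F => ?_
  have hleft : Tendsto (fun n => ∑ x ∈ F, κ x {y} * cesaroLaw κ o n {x}) U
      (𝓝 (∑ x ∈ F, κ x {y} * m x)) :=
    tendsto_finsetSum F fun x _ =>
      ENNReal.Tendsto.const_mul (hmx x) (Or.inr (measure_ne_top _ _))
  have hright : Tendsto (fun n : ℕ => cesaroLaw κ o n {y} + (n : ENNReal)⁻¹) U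
      (𝓝 (m y + 0)) :=
    (hmx y).add (ENNReal.tendsto_inv_nat_nhds_zero.mono_left hU)
  rw [add_zero] at hright
  refine le_of_tendsto_of_tendsto hleft hright (.of_forall fun n => ?_)
  refine le_trans ?_ (bind_cesaroLaw_le κ o n {y})
  rw [lintegral_countable']
  exact ENNReal.sum_le_tsum _

end Chain

/-! ### Where a particle leaves a cluster -/

section Exit

open Filter Topology

variable {N : ℕ}

lemma walk_zero (ω : Particle N) : walk ω 0 = (ω.1, 0) := by simp [walk]

lemma walk_succ (ω : Particle N) (n : ℕ) : walk ω (n + 1) = walk ω n + dir N (ω.2 n) := by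
  simp [walk, Finset.sum_range_succ, add_assoc]

lemma exitSite_notMem {A : Set (Site N)} {ω : Particle N} (h : ∃ n, walk ω n ∉ A) :
    exitSite A ω ∉ A := Nat.sInf_mem (s := {n | walk ω n ∉ A}) h

lemma walk_mem_of_lt_exitTime {A : Set (Site N)} {ω : Particle N} {n : ℕ}
    (h : n < exitTime A ω) : walk ω n ∈ A :=
  not_not.1 (Nat.notMem_of_lt_sInf (s := {n | walk ω n ∉ A}) h)

lemma stoppedWalk_eq_walk {A : Set (Site N)} {ω : Particle N} {n : ℕ}
    (h : ∀ m < n, walk ω m ∈ A) : stoppedWalk A (ω.1, 0) ω.2 n = walk ω n := by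
  induction n with
  | zero => rw [walk_zero]; rfl
  | succ n ih =>
    rw [stoppedWalk, ih fun m hm => h m (by omega), if_pos (h n (by omega)), walk_succ]

lemma stoppedWalk_eq_exitSite {A : Set (Site N)} {ω : Particle N} (h : ∃ n, walk ω n ∉ A) {n : ℕ}
    (hn : exitTime A ω ≤ n) : stoppedWalk A (ω.1, 0) ω.2 n = exitSite A ω := by
  induction n, hn using Nat.le_induction with
  | base => exact stoppedWalk_eq_walk fun m hm => walk_mem_of_lt_exitTime hm
  | succ n _ ih => rw [stoppedWalk, ih, if_neg (exitSite_notMem h)]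

lemma dir_snd_le (d : Fin 4) : (dir N d).2 ≤ 1 := by
  fin_cases d <;> simp [dir]

lemma exitSite_snd_le (A : Cluster N) (ω : Particle N) :
    (exitSite A.carrier ω).2 ≤ height A + 1 := by
  have h0 : walk ω 0 ∈ A.carrier := mem_of_le_zero A (by simp [walk_zero])
  rw [exitSite]
  -- The case of exit time 0 also covers the default value for a particle that never leaves.
  rcases hT : exitTime A.carrier ω with _ | T
  · have := le_height h0
    omega
  · have h1 := le_height (walk_mem_of_lt_exitTime (A := A.carrier) (ω := ω) (n := T) (by omega))
    have h2 := dir_snd_le (N := N) (ω.2 T)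
    rw [walk_succ, Prod.snd_add]
    omega

lemma ofReal_mean (f : Fin 4 → ℝ) (hf : ∀ d, 0 ≤ f d) :
    (∑ d, ENNReal.ofReal (f d)) / 4 = ENNReal.ofReal ((∑ d, f d) / 4) := by
  rw [← ENNReal.ofReal_sum_of_nonneg fun d _ => hf d, ENNReal.ofReal_div_of_pos (by norm_num)]
  simp

/-- The hole `(x₀, 1)` lies outside the cluster, so the potential kernel with its pole there is
harmonic along the walk up to the exit; its initial value is compared with its value at an exit
above the height. -/
lemma measure_exit_above_le [NeZero N] (A : Cluster N) (hA : fillLevel A = 0) (hpos : 0 < height A)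
    (x : ZMod N) :
    stepLaw {s | (∃ n, walk (x, s) n ∉ A.carrier) ∧ height A < (exitSite A.carrier (x, s)).2} ≤
      ENNReal.ofReal ((1 + 2 * (N : ℝ) ^ 2) / height A) := by
  obtain ⟨x₀, hx₀⟩ := exists_hole A hA
  have hR : (0 : ℝ) < height A := by exact_mod_cast hpos
  let u : Site N → ENNReal := fun q => ENNReal.ofReal (potential (q - (x₀, 1)))
  have hu : ∀ q ∈ A.carrier, (∑ d, u (q + dir N d)) / 4 ≤ u q := by
    intro q hq
    simp only [u]
    rw [ofReal_mean _ fun d => (abs_nonneg _).trans (abs_le_potential _)]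
    simp only [add_sub_right_comm]
    rw [sum_potential _ (sub_ne_zero.2 (ne_of_mem_of_not_mem hq hx₀)), mul_div_cancel_left₀ _ (by norm_num)]
  -- The maximal inequality concerns a fixed time, so the event is exhausted by the times `n` before
  -- which the exit occurs.
  let E : ℕ → Set (ℕ → Fin 4) := fun n => {s | (∃ m, walk (x, s) m ∉ A.carrier) ∧
    exitTime A.carrier (x, s) ≤ n ∧ height A < (exitSite A.carrier (x, s)).2}
  have hE : {s | (∃ n, walk (x, s) n ∉ A.carrier) ∧
      height A < (exitSite A.carrier (x, s)).2} = ⋃ n, E n := by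
    ext s
    simp only [E, mem_ofPred_eq, mem_iUnion]
    exact ⟨fun h => ⟨_, h.1, le_rfl, h.2⟩, fun ⟨n, h1, _, h2⟩ => ⟨h1, h2⟩⟩
  have hmono : Monotone E := fun m n hmn s hs => ⟨hs.1, hs.2.1.trans hmn, hs.2.2⟩
  rw [hE, hmono.measure_iUnion]
  refine iSup_le fun n => ?_
  have hsub : E n ⊆ {s | ENNReal.ofReal (height A) ≤ u (stoppedWalk A.carrier (x, 0) s n)} := by
    rintro s ⟨h1, h2, h3⟩
    have := stoppedWalk_eq_exitSite h1 h2
    simp only at this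
    simp only [mem_ofPred_eq, u, this]
    refine ENNReal.ofReal_le_ofReal (le_trans ?_ (abs_le_potential _))
    refine le_trans ?_ (le_abs_self _)
    -- The pole sits on level 1 and the exit is above `height A`, so they are at least `height A`
    -- levels apart.
    have h4 : height A ≤ (exitSite A.carrier (x, s)).2 - 1 := by omega
    exact_mod_cast h4
  refine (measure_mono hsub).trans ((measure_stoppedWalk_le hu (x, 0) n
    (ENNReal.ofReal_pos.2 hR).ne' ENNReal.ofReal_ne_top).trans ?_)
  rw [ENNReal.ofReal_div_of_pos hR]
  gcongr
  exact ENNReal.ofReal_le_ofReal ((potential_le _).trans (by simp))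

/-- The harmonic numbers as a function of the depth below level `m`. -/
def depthHarmonic (m : ℤ) (q : Site N) : ℝ :=
  ∑ i ∈ Finset.range (m - q.2).toNat, 1 / ((i : ℝ) + 1)

lemma depthHarmonic_nonneg (m : ℤ) (q : Site N) : 0 ≤ depthHarmonic m q :=
  Finset.sum_nonneg fun i _ => by positivity

/-- At depth `t` the second difference of the harmonic numbers is `1 / (t + 1) - 1 / t`. The point
is a function that is strictly superharmonic yet unbounded in the depth. -/
lemma mean_depthHarmonic (m : ℤ) (q : Site N) (hq : q.2 < m) :
    (∑ d, depthHarmonic m (q + dir N d)) / 4 +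
      1 / (4 * ((m - q.2).toNat : ℝ) * ((m - q.2).toNat + 1)) = depthHarmonic m q := by
  rw [sum_dir]
  obtain ⟨t, ht⟩ : ∃ t : ℕ, m - q.2 = t + 1 := ⟨(m - q.2 - 1).toNat, by omega⟩
  simp only [depthHarmonic]
  rw [show (m - q.2).toNat = t + 1 by omega, show (m - (q.2 + 1)).toNat = t by omega,
    show (m - (q.2 - 1)).toNat = t + 2 by omega]
  simp only [Finset.sum_range_succ]
  push_cast
  field_simp
  ring

/-- The walk leaves a cluster almost surely. -/
lemma ae_exists_walk_notMem [NeZero N] (A : Cluster N) (x : ZMod N) :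
    ∀ᵐ s ∂stepLaw, ∃ n, walk (x, s) n ∉ A.carrier := by
  let m := height A + 1
  let u : Site N → ENNReal := fun q => ENNReal.ofReal (depthHarmonic m q)
  let φ : ℕ → ENNReal := fun t => ENNReal.ofReal (1 / (4 * (t : ℝ) * (t + 1)))
  let c : Site N → ENNReal := fun q => φ (m - q.2).toNat
  let Y : ℕ → (ℕ → Fin 4) → Site N := fun n s => stoppedWalk A.carrier (x, 0) s n
  have hlt : ∀ q ∈ A.carrier, q.2 < m := fun q hq => Int.lt_add_one_iff.2 (le_height hq)
  have huc : ∀ q ∈ A.carrier, (∑ d, u (q + dir N d)) / 4 + c q ≤ u q := by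
    intro q hq
    simp only [u, c, φ]
    rw [ofReal_mean _ fun d => depthHarmonic_nonneg _ _, ← ENNReal.ofReal_add
      (div_nonneg (Finset.sum_nonneg fun d _ => depthHarmonic_nonneg _ _) (by norm_num))
      (by positivity), mean_depthHarmonic m q (hlt q hq)]
  have hbound := lintegral_stoppedWalk_add_sum_le huc (x, 0)
  have hYm : ∀ (f : Site N → ENNReal) n, Measurable fun s => f (Y n s) := fun f n =>
    (Measurable.of_discrete (f := f)).comp (measurable_stoppedWalk _ _ n)
  -- If the walk stayed in the cluster forever, summability of the drift would force its depth to
  -- infinity and hence `u` to infinity, against the finite `liminf` that Fatou's lemma gives in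
  -- `h2`.
  have h1 : ∀ᵐ s ∂stepLaw, ∑' n, A.carrier.indicator c (Y n s) < ⊤ := by
    refine ae_lt_top (Measurable.tsum fun n => hYm _ n) ?_
    rw [lintegral_tsum fun n => (hYm _ n).aemeasurable]
    refine ne_top_of_le_ne_top (b := u (x, 0)) ENNReal.ofReal_ne_top ?_
    rw [ENNReal.tsum_eq_iSup_nat]
    exact iSup_le fun n => le_trans le_add_self (hbound n)
  have h2 : ∀ᵐ s ∂stepLaw, liminf (fun n => u (Y n s)) atTop < ⊤ := by
    refine ae_lt_top (.liminf fun n => hYm u n) ?_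
    refine ne_top_of_le_ne_top (b := u (x, 0)) ENNReal.ofReal_ne_top ?_
    refine (lintegral_liminf_le fun n => hYm u n).trans ?_
    exact (liminf_le_liminf (.of_forall fun n => le_trans le_self_add (hbound n))).trans (by simp)
  filter_upwards [h1, h2] with s hs1 hs2
  by_contra! hin
  have hY : ∀ n, Y n s ∈ A.carrier := by
    intro n
    have := stoppedWalk_eq_walk (ω := (x, s)) (n := n) fun m _ => hin m
    simp only at this
    simp only [Y, this, hin n]
  have hc : Tendsto (fun n => c (Y n s)) atTop (𝓝 0) := by
    have := ENNReal.tendsto_atTop_zero_of_tsum_ne_top hs1.ne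
    refine this.congr fun n => ?_
    rw [indicator_of_mem (hY n)]
  have hL : ∀ L : ℕ, ENNReal.ofReal (∑ i ∈ Finset.range L, 1 / ((i : ℝ) + 1)) ≤
      liminf (fun n => u (Y n s)) atTop := by
    intro L
    refine le_liminf_of_le (by isBoundedDefault) ?_
    have hφ : 0 < φ (L + 1) := ENNReal.ofReal_pos.2 (by positivity)
    filter_upwards [hc.eventually_lt_const hφ] with n hn
    have hlarge : L ≤ (m - (Y n s).2).toNat := by
      by_contra! hcon
      refine absurd hn (not_lt.2 (ENNReal.ofReal_le_ofReal ?_))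
      have h1 := hlt _ (hY n)
      have h2 : (1 : ℝ) ≤ ((m - (Y n s).2).toNat : ℝ) := by
        exact_mod_cast (by omega : 1 ≤ (m - (Y n s).2).toNat)
      have h3 : ((m - (Y n s).2).toNat : ℝ) ≤ ((L + 1 : ℕ) : ℝ) := by
        exact_mod_cast (by omega : (m - (Y n s).2).toNat ≤ L + 1)
      gcongr
    refine ENNReal.ofReal_le_ofReal ?_
    exact Finset.sum_le_sum_of_subset_of_nonneg (Finset.range_mono hlarge)
      fun _ _ _ => by positivity
  have htop := ENNReal.tendsto_ofReal_nhds_top.2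
    Real.tendsto_sum_range_one_div_nat_succ_atTop
  exact absurd (le_of_tendsto htop (.of_forall hL)) (not_le.2 hs2)

/-- The probability that a particle does not settle at a vacant site at or below the height. -/
lemma measure_not_settle_le [NeZero N] (A : Cluster N) (hA : fillLevel A = 0)
    (hpos : 0 < height A) :
    particleLaw N {ω | exitSite A.carrier ω ∈ A.carrier ∨ height A < (exitSite A.carrier ω).2} ≤
      ENNReal.ofReal ((1 + 2 * (N : ℝ) ^ 2) / height A) := by
  have hmeas : MeasurableSet {ω : Particle N | exitSite A.carrier ω ∈ A.carrier ∨
      height A < (exitSite A.carrier ω).2} :=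
    measurable_exitSite A.carrier
      (MeasurableSet.of_discrete (s := {q | q ∈ A.carrier ∨ height A < q.2}))
  rw [particleLaw, Measure.prod_apply hmeas]
  calc _ ≤ ∫⁻ _, ENNReal.ofReal ((1 + 2 * (N : ℝ) ^ 2) / height A)
        ∂(PMF.uniformOfFintype (ZMod N)).toMeasure := by
        refine lintegral_mono fun x => ?_
        refine le_trans (measure_mono_ae ?_) (measure_exit_above_le A hA hpos x)
        filter_upwards [ae_exists_walk_notMem A x] with s hs h
        exact ⟨hs, h.resolve_left (exitSite_notMem hs)⟩
    _ = _ := by simp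

end Exit

/-! ### The Lyapunov function of Shifted IDLA -/

section Drift

variable {N : ℕ}

lemma measurable_shifted_next [NeZero N] (A : Cluster N) :
    Measurable fun ω => downshift (A.insert (exitSite A.carrier ω)) :=
  (Measurable.of_discrete (f := fun z => downshift (A.insert z))).comp (measurable_exitSite _)

lemma shiftedKernel_eq_map [NeZero N] (A : Cluster N) :
    shiftedKernel N A =
      (particleLaw N).map fun ω => downshift (A.insert (exitSite A.carrier ω)) := by
  rw [shiftedKernel, Kernel.map_apply _ Measurable.of_discrete]
  exact Measure.map_map Measurable.of_discrete
    ((Measurable.of_discrete (f := A.insert)).comp (measurable_exitSite _))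

lemma shiftedKernel_fillLevel_ne_zero [NeZero N] (A : Cluster N) :
    shiftedKernel N A {B | fillLevel B ≠ 0} = 0 := by
  rw [shiftedKernel_eq_map, Measure.map_apply (measurable_shifted_next A) .of_discrete]
  simp [fillLevel_downshift]

/-- Every transition ends with a downshift, so a stationary law equals its own image on downshifted
clusters. -/
lemma ae_fillLevel_eq_zero [NeZero N] {μ : Measure (Cluster N)}
    (hμ : (shiftedKernel N).Invariant μ) : ∀ᵐ A ∂μ, fillLevel A = 0 := by
  rw [ae_iff]
  change μ {B | fillLevel B ≠ 0} = 0
  rw [← hμ.def, bind_kernel_apply]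
  simp [shiftedKernel_fillLevel_ne_zero]

/-- The exponent of the Lyapunov function. -/
def energy (A : Cluster N) : ℝ := vacancy A / N + height A

lemma energy_downshift_le (A : Cluster N) : energy (downshift A) ≤ energy A := by
  have : ((height (downshift A) : ℤ) : ℝ) ≤ height A := by
    rw [height_downshift]
    push_cast
    linarith [(Nat.cast_nonneg (fillLevel A) : (0 : ℝ) ≤ fillLevel A)]
  rw [energy, energy, vacancy_downshift]
  linarith

lemma height_le_energy (A : Cluster N) : (height A : ℝ) ≤ energy A :=
  le_add_of_nonneg_left (by positivity)

lemma energy_le [NeZero N] (A : Cluster N) : energy A ≤ 2 * height A := by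
  have hN : (0 : ℝ) < N := by exact_mod_cast Nat.pos_of_ne_zero (NeZero.ne N)
  have : (vacancy A : ℝ) ≤ N * height A := by exact_mod_cast vacancy_le A
  have : (vacancy A : ℝ) / N ≤ height A := by
    rw [div_le_iff₀ hN]
    linarith
  rw [energy]
  linarith

lemma energy_next_le [NeZero N] (A : Cluster N) (ω : Particle N) :
    energy (downshift (A.insert (exitSite A.carrier ω))) ≤ energy A + 2 := by
  have hN : (0 : ℝ) < N := by exact_mod_cast Nat.pos_of_ne_zero (NeZero.ne N)
  have hz := exitSite_snd_le A ω
  refine (energy_downshift_le _).trans ?_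
  have h1 : (vacancy (A.insert (exitSite A.carrier ω)) : ℝ) ≤ vacancy A + N := by
    exact_mod_cast vacancy_insert_le A hz
  have h2 : (height (A.insert (exitSite A.carrier ω)) : ℝ) ≤ height A + 1 := by
    rw [height_insert]
    exact_mod_cast max_le (by omega) hz
  have h3 : (vacancy (A.insert (exitSite A.carrier ω)) : ℝ) / N ≤ vacancy A / N + 1 := by
    rw [div_add_one hN.ne']
    gcongr
  rw [energy, energy]
  linarith

lemma energy_next_le_of_settle [NeZero N] (A : Cluster N) (ω : Particle N)
    (h1 : exitSite A.carrier ω ∉ A.carrier) (h2 : (exitSite A.carrier ω).2 ≤ height A) :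
    energy (downshift (A.insert (exitSite A.carrier ω))) ≤ energy A - 1 / N := by
  refine (energy_downshift_le _).trans ?_
  have h3 : (vacancy (A.insert (exitSite A.carrier ω)) : ℝ) + 1 = vacancy A := by
    exact_mod_cast vacancy_insert_of_le A h1 h2
  rw [energy, energy, height_insert, max_eq_left h2, ← h3, add_div]
  linarith

/-- The Lyapunov function; clusters that are not downshifted get the value `⊤`. -/
def lyapunov (A : Cluster N) : ENNReal :=
  if fillLevel A = 0 then ENNReal.ofReal (Real.exp (energy A)) else ⊤

lemma lyapunov_eq {A : Cluster N} (hA : fillLevel A = 0) :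
    lyapunov A = ENNReal.ofReal (Real.exp (energy A)) := if_pos hA

lemma exp_height_le_lyapunov (A : Cluster N) :
    ENNReal.ofReal (Real.exp (height A)) ≤ lyapunov A := by
  unfold lyapunov
  split_ifs
  · exact ENNReal.ofReal_le_ofReal (Real.exp_le_exp.2 (height_le_energy A))
  · exact le_top

lemma lintegral_lyapunov [NeZero N] (A : Cluster N) :
    ∫⁻ B, lyapunov B ∂shiftedKernel N A = ∫⁻ ω, ENNReal.ofReal (Real.exp
      (energy (downshift (A.insert (exitSite A.carrier ω))))) ∂particleLaw N := by
  rw [shiftedKernel_eq_map, lintegral_map .of_discrete (measurable_shifted_next A)]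
  simp only [lyapunov_eq (fillLevel_downshift _)]

lemma exp_two_le : Real.exp 2 ≤ 9 := by
  have h := Real.exp_one_lt_d9
  rw [show (2 : ℝ) = 1 + 1 by norm_num, Real.exp_add]
  nlinarith [Real.exp_pos 1]

/-- The mean factor by which the Lyapunov function changes at large heights. -/
lemma drift_factor_le (hN : 4 ≤ N) {h : ℝ} (hh : (N : ℝ) ^ 7 ≤ h) :
    Real.exp (-(1 / (N : ℝ))) + Real.exp 2 * ((1 + 2 * (N : ℝ) ^ 2) / h) ≤ 1 - 1 / (4 * N) := by
  have hN4 : (4 : ℝ) ≤ N := by exact_mod_cast hN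
  have hN0 : (0 : ℝ) < N := by linarith
  -- With `x = 1 / N ≤ 1`: `exp (-x) ≤ 1 / (1 + x) ≤ 1 - x / 2`. Half of this gain pays for the term
  -- with `exp 2`.
  have h1 : Real.exp (-(1 / (N : ℝ))) ≤ 1 - 1 / (2 * N) := by
    have h2 : 1 + 1 / (N : ℝ) ≤ Real.exp (1 / N) := by
      linarith [Real.add_one_le_exp (1 / (N : ℝ))]
    rw [Real.exp_neg]
    refine (inv_anti₀ (by positivity) h2).trans ?_
    rw [inv_le_iff_one_le_mul₀ (by positivity)]
    field_simp
    nlinarith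
  have h2 : Real.exp 2 * ((1 + 2 * (N : ℝ) ^ 2) / h) ≤ 1 / (4 * N) := by
    have h7 : (0 : ℝ) < (N : ℝ) ^ 7 := by positivity
    calc _ ≤ 9 * ((1 + 2 * (N : ℝ) ^ 2) / (N : ℝ) ^ 7) := by
          have h0 : 0 < h := h7.trans_le hh
          gcongr
          exact exp_two_le
      _ ≤ 9 * (3 * (N : ℝ) ^ 2 / (N : ℝ) ^ 7) := by
          gcongr
          nlinarith
      _ ≤ 1 / (4 * N) := by
          -- The required inequality is `108 ≤ N ^ 4`, which `N ≥ 4` guarantees.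
          have h4 : (4 : ℝ) ^ 4 ≤ (N : ℝ) ^ 4 := pow_le_pow_left₀ (by norm_num) hN4 4
          rw [← mul_div_assoc, div_le_div_iff₀ h7 (by positivity)]
          have : (N : ℝ) ^ 7 = (N : ℝ) ^ 3 * (N : ℝ) ^ 4 := by ring
          rw [this]
          nlinarith [pow_pos hN0 3]
  have h3 : 1 / (2 * (N : ℝ)) = 1 / (4 * N) + 1 / (4 * N) := by field_simp; norm_num
  linarith

lemma one_sub_drift_pos (hN : 4 ≤ N) : 0 < 1 - 1 / (4 * (N : ℝ)) := by
  have hN4 : (4 : ℝ) ≤ N := by exact_mod_cast hN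
  rw [sub_pos, div_lt_one (by linarith)]
  linarith

/-- The drift condition. -/
lemma lintegral_lyapunov_le [NeZero N] (hN : 4 ≤ N) (A : Cluster N) :
    ∫⁻ B, lyapunov B ∂shiftedKernel N A ≤
      ENNReal.ofReal (1 - 1 / (4 * N)) * lyapunov A +
        ENNReal.ofReal (Real.exp (2 * (N : ℝ) ^ 7 + 2)) := by
  by_cases hA : fillLevel A = 0
  swap
  -- Off the downshifted clusters the right-hand side is `⊤`, since the contraction factor is
  -- positive.
  · rw [lyapunov, if_neg hA, ENNReal.mul_top (ENNReal.ofReal_pos.2 (one_sub_drift_pos hN)).ne']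
    simp
  rw [lintegral_lyapunov]
  rcases le_or_gt ((N : ℝ) ^ 7) (height A) with hh | hh
  · refine le_add_of_le_of_nonneg ?_ zero_le
    have hN0 : (0 : ℝ) < N := by exact_mod_cast (by omega : 0 < N)
    have hpos : 0 < height A := by
      exact_mod_cast (lt_of_lt_of_le (by positivity : (0 : ℝ) < (N : ℝ) ^ 7) hh)
    let S : Set (Particle N) :=
      {ω | exitSite A.carrier ω ∈ A.carrier ∨ height A < (exitSite A.carrier ω).2}
    have hS : MeasurableSet S := measurable_exitSite A.carrier
      (MeasurableSet.of_discrete (s := {q | q ∈ A.carrier ∨ height A < q.2}))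
    have hpt : ∀ ω, ENNReal.ofReal (Real.exp
        (energy (downshift (A.insert (exitSite A.carrier ω))))) ≤
        ENNReal.ofReal (Real.exp (-(1 / (N : ℝ)))) * lyapunov A +
          S.indicator (fun _ => ENNReal.ofReal (Real.exp 2) * lyapunov A) ω := by
      intro ω
      rw [lyapunov_eq hA, ← ENNReal.ofReal_mul (Real.exp_pos _).le,
        ← ENNReal.ofReal_mul (Real.exp_pos _).le, ← Real.exp_add, ← Real.exp_add]
      by_cases hω : ω ∈ S
      · rw [indicator_of_mem hω]
        refine le_add_of_nonneg_of_le zero_le (ENNReal.ofReal_le_ofReal (Real.exp_le_exp.2 ?_))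
        linarith [energy_next_le A ω]
      · rw [indicator_of_notMem hω, add_zero]
        refine ENNReal.ofReal_le_ofReal (Real.exp_le_exp.2 ?_)
        have h := not_or.1 hω
        linarith [energy_next_le_of_settle A ω h.1 (not_lt.1 h.2)]
    refine (lintegral_mono hpt).trans ?_
    rw [lintegral_add_left measurable_const, lintegral_const, measure_univ, mul_one,
      lintegral_indicator_const hS]
    calc _ ≤ ENNReal.ofReal (Real.exp (-(1 / (N : ℝ)))) * lyapunov A +
          ENNReal.ofReal (Real.exp 2) * lyapunov A *
            ENNReal.ofReal ((1 + 2 * (N : ℝ) ^ 2) / height A) := by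
          gcongr
          exact measure_not_settle_le A hA hpos
      _ = ENNReal.ofReal (Real.exp (-(1 / (N : ℝ))) +
            Real.exp 2 * ((1 + 2 * (N : ℝ) ^ 2) / height A)) * lyapunov A := by
          have hR : (0 : ℝ) < height A := by exact_mod_cast hpos
          rw [ENNReal.ofReal_add (Real.exp_pos _).le (by positivity),
            ENNReal.ofReal_mul (Real.exp_pos _).le]
          ring
      _ ≤ _ := by
          gcongr
          exact drift_factor_le hN hh
  -- Below height `N ^ 7` the energy is at most `2 * N ^ 7`, and one step adds at most 2.
  · refine le_add_of_nonneg_of_le zero_le ?_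
    calc _ ≤ ∫⁻ _, ENNReal.ofReal (Real.exp (2 * (N : ℝ) ^ 7 + 2)) ∂particleLaw N := by
          refine lintegral_mono fun ω => ENNReal.ofReal_le_ofReal (Real.exp_le_exp.2 ?_)
          linarith [energy_next_le A ω, energy_le A]
      _ = _ := by simp

end Drift

/-! ### Accessibility of the flat cluster -/

section Flat

variable {N : ℕ}

lemma particleLaw_first_step_pos [NeZero N] (x : ZMod N) (d : Fin 4) :
    particleLaw N ({x} ×ˢ {s | s 0 = d}) ≠ 0 := by
  have h : (Measure.infinitePi fun _ : ℕ => (PMF.uniformOfFintype (Fin 4)).toMeasure)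
      {s | s 0 = d} = (PMF.uniformOfFintype (Fin 4)).toMeasure {d} := by
    conv_rhs =>
      rw [← Measure.infinitePi_map_eval (fun _ : ℕ => (PMF.uniformOfFintype (Fin 4)).toMeasure) 0,
        Measure.map_apply (measurable_pi_apply 0) (measurableSet_singleton d)]
    rfl
  rw [particleLaw, Measure.prod_prod, h,
    PMF.toMeasure_apply_singleton _ _ (measurableSet_singleton _),
    PMF.toMeasure_apply_singleton _ _ (measurableSet_singleton _)]
  simp

/-- The particle starts just below the hole and steps up, direction `2` being `(0, 1)`. -/
lemma exitSite_eq_of_hole {A : Cluster N} {x : ZMod N} (hx : ((x, 1) : Site N) ∉ A.carrier)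
    {ω : Particle N} (h1 : ω.1 = x) (h2 : ω.2 0 = 2) : exitSite A.carrier ω = (x, 1) := by
  have hw0 : walk ω 0 = (x, 0) := by rw [walk_zero, h1]
  have hw1 : walk ω 1 = (x, 1) := by
    rw [walk_succ, hw0, h2]
    simp [dir]
  have hT : exitTime A.carrier ω = 1 := by
    refine le_antisymm (Nat.sInf_le (by simpa [hw1] using hx)) ?_
    rw [Nat.one_le_iff_ne_zero]
    intro h0
    have : exitSite A.carrier ω ∉ A.carrier := exitSite_notMem ⟨1, by rwa [hw1]⟩
    rw [exitSite, h0, hw0] at this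
    exact this (mem_of_le_zero A le_rfl)
  rw [exitSite, hT, hw1]

lemma shiftedKernel_fill_hole_ne_zero [NeZero N] {A : Cluster N} {x : ZMod N}
    (hx : ((x, 1) : Site N) ∉ A.carrier) :
    shiftedKernel N A {downshift (A.insert (x, 1))} ≠ 0 := by
  rw [shiftedKernel_eq_map, Measure.map_apply (measurable_shifted_next A) .of_discrete]
  intro h
  refine particleLaw_first_step_pos x 2 (measure_mono_null ?_ h)
  rintro ω ⟨h1, h2⟩
  simp only [mem_preimage, mem_singleton_iff]
  rw [exitSite_eq_of_hole hx h1 h2]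

/-- Filling a level-1 hole has positive probability and removes one vacancy; the downshift restores
no vacancy, so induction on the vacancy count ends at the flat cluster. -/
lemma flat_charged [NeZero N] {μ : Measure (Cluster N)} (hμ : (shiftedKernel N).Invariant μ) (n : ℕ)
    (A : Cluster N) (hA : fillLevel A = 0) (hn : vacancy A = n) (hAμ : μ {A} ≠ 0) :
    μ {flat N} ≠ 0 := by
  induction n generalizing A with
  | zero => rwa [← eq_flat hA hn]
  | succ n ih =>
    obtain ⟨x, hx⟩ := exists_hole A hA
    -- A remaining vacancy forces positive height, so filling a level-1 hole does not raise the
    -- height.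
    have hh : 1 ≤ height A := by
      have h1 := vacancy_le A
      have h2 := height_nonneg A
      by_contra! hlt
      rw [show height A = 0 by omega, hn] at h1
      simp at h1
      omega
    refine ih (downshift (A.insert (x, 1))) (fillLevel_downshift _) ?_
      (charged_of_transition hμ hAμ (shiftedKernel_fill_hole_ne_zero hx))
    have := vacancy_insert_of_le A hx hh
    rw [vacancy_downshift]
    omega

lemma eq_zero_of_flat [NeZero N] {μ : Measure (Cluster N)} (hμ : (shiftedKernel N).Invariant μ)
    (h : μ {flat N} = 0) : μ = 0 := by
  refine Measure.ext_of_singleton fun A => ?_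
  by_contra hA
  have hA0 : μ {A} ≠ 0 := hA
  by_cases hf : fillLevel A = 0
  · exact flat_charged hμ _ A hf rfl hA0 h
  · refine hA0 (measure_mono_null ?_ (ae_iff.1 (ae_fillLevel_eq_zero hμ)))
    simpa using hf

lemma height_flat : height (flat N) = 0 :=
  le_antisymm (by obtain ⟨x, hx⟩ := (isGreatest_height (flat N)).1; exact hx) (height_nonneg _)

lemma fillLevel_flat : fillLevel (flat N) = 0 := by
  have := le_height_of_rect_subset (rect_fillLevel_subset (flat N))
  rw [height_flat] at this
  omega

end Flat

/-! ### The stationary distribution -/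

lemma exists_isStationary {N : ℕ} [NeZero N] (hN : 4 ≤ N) :
    ∃ μ : Measure (Cluster N), IsStationary N μ := by
  have hN0 : (0 : ℝ) < N := by exact_mod_cast (by omega : 0 < N)
  have hr := one_sub_drift_pos hN
  set b : ℝ := Real.exp (2 * (N : ℝ) ^ 7 + 2) with hb
  set e : ℝ := Real.exp (energy (flat N)) with he
  -- The term `4 * N * b` is the fixed point of `C ↦ (1 - 1 / (4 * N)) * C + b`; adding `e` covers
  -- the initial value.
  refine exists_invariant (κ := shiftedKernel N) (o := flat N) (V := lyapunov)
    (C := ENNReal.ofReal (e + 4 * N * b)) (lintegral_lyapunov_le hN) ?_ ?_ ENNReal.ofReal_ne_top ?_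
  · rw [lyapunov_eq fillLevel_flat]
    exact ENNReal.ofReal_le_ofReal (le_add_of_nonneg_right (by positivity))
  · rw [← ENNReal.ofReal_mul hr.le, ← ENNReal.ofReal_add (by positivity) (by positivity)]
    refine ENNReal.ofReal_le_ofReal ?_
    have h1 : 1 / (4 * (N : ℝ)) * (4 * N * b) = b := by field_simp
    have h2 : 0 ≤ 1 / (4 * (N : ℝ)) * e := by positivity
    nlinarith
  · intro M
    refine (finite_height_le N M).subset fun A hA => ?_
    have h := (exp_height_le_lyapunov A).trans_lt hA
    rw [← ENNReal.ofReal_natCast, ENNReal.ofReal_lt_ofReal_iff_of_nonneg (Real.exp_pos _).le] at h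
    have h2 : (height A : ℝ) < M := by linarith [Real.add_one_le_exp (height A : ℝ)]
    have h3 : height A < M := by exact_mod_cast h2
    exact h3.le

lemma measure_height_gt_le {N : ℕ} [NeZero N] (hN : 8 ≤ N) {μ : Measure (Cluster N)}
    (hμ : IsStationary N μ) :
    μ {A | (N : ℤ) ^ 8 < height A} ≤ ENNReal.ofReal (2 * Real.exp (-(N : ℝ) / 2)) := by
  obtain ⟨hprob, hinv⟩ := hμ
  have hN8 : (8 : ℝ) ≤ N := by exact_mod_cast hN
  have hN0 : (0 : ℝ) < N := by linarith
  have hr := one_sub_drift_pos (N := N) (by omega)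
  have hV : ∀ᵐ A ∂μ, lyapunov A ≠ ⊤ := by
    filter_upwards [ae_fillLevel_eq_zero hinv] with A hA
    rw [lyapunov_eq hA]
    exact ENNReal.ofReal_ne_top
  have hint := lintegral_le_of_drift hinv hV
    (ENNReal.ofReal_le_one.2 (by linarith [(by positivity : 0 < 1 / (4 * (N : ℝ)))]))
    ENNReal.ofReal_ne_top (lintegral_lyapunov_le (N := N) (by omega))
  have hmarkov : ENNReal.ofReal (Real.exp ((N : ℝ) ^ 8)) * μ {A | (N : ℤ) ^ 8 < height A} ≤
      ∫⁻ A, lyapunov A ∂μ := by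
    refine le_trans ?_ (mul_meas_ge_le_lintegral₀ Measurable.of_discrete.aemeasurable
      (ENNReal.ofReal (Real.exp ((N : ℝ) ^ 8))))
    gcongr with A
    intro hA
    refine le_trans (ENNReal.ofReal_le_ofReal (Real.exp_le_exp.2 ?_)) (exp_height_le_lyapunov A)
    exact_mod_cast hA.le
  have hone : 1 - ENNReal.ofReal (1 - 1 / (4 * (N : ℝ))) = ENNReal.ofReal (1 / (4 * N)) := by
    rw [← ENNReal.ofReal_one, ← ENNReal.ofReal_sub _ hr.le]
    congr 1
    ring
  have hall : ENNReal.ofReal (1 / (4 * N) * Real.exp ((N : ℝ) ^ 8)) *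
      μ {A | (N : ℤ) ^ 8 < height A} ≤ ENNReal.ofReal (Real.exp (2 * (N : ℝ) ^ 7 + 2)) := by
    rw [ENNReal.ofReal_mul (by positivity), mul_assoc, ← hone]
    exact le_trans (by gcongr) hint
  have hpos : (0 : ℝ) < 1 / (4 * N) * Real.exp ((N : ℝ) ^ 8) := by positivity
  rw [mul_comm] at hall
  refine (ENNReal.le_div_iff_mul_le (Or.inl (ENNReal.ofReal_pos.2 hpos).ne')
    (Or.inl ENNReal.ofReal_ne_top)).2 hall |>.trans ?_
  rw [← ENNReal.ofReal_div_of_pos hpos]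
  refine ENNReal.ofReal_le_ofReal ?_
  rw [div_le_iff₀ hpos]
  have h1 : 2 * (N : ℝ) ≤ Real.exp (2 * N) := by linarith [Real.add_one_le_exp (2 * (N : ℝ))]
  have h7 : (N : ℝ) ≤ (N : ℝ) ^ 7 := le_self_pow₀ (by linarith) (by norm_num)
  -- This is where `N ≥ 8` enters: `8 * N ^ 7` dominates `2 * N ^ 7 + 2`, the prefactor `2 * N ≤ exp
  -- (2 * N)` and the target exponent `N / 2` together.
  have h8 : 8 * (N : ℝ) ^ 7 ≤ (N : ℝ) ^ 8 := by
    rw [pow_succ (N : ℝ) 7]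
    nlinarith [pow_pos hN0 7]
  have h2 : Real.exp (2 * (N : ℝ)) * Real.exp (2 * (N : ℝ) ^ 7 + 2) ≤
      Real.exp (-(N : ℝ) / 2) * Real.exp ((N : ℝ) ^ 8) := by
    rw [← Real.exp_add, ← Real.exp_add]
    refine Real.exp_le_exp.2 ?_
    linarith
  have h3 : 2 * Real.exp (-(N : ℝ) / 2) * (1 / (4 * N) * Real.exp ((N : ℝ) ^ 8)) =
      Real.exp (-(N : ℝ) / 2) * Real.exp ((N : ℝ) ^ 8) / (2 * N) := by
    field_simp
    ring
  rw [h3, le_div_iff₀ (by positivity)]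
  refine le_trans ?_ h2
  rw [mul_comm]
  gcongr

end ShiftedIDLA
end

theorem mainTheorem8 :
    ∃ N₀ : ℕ, ∀ (N : ℕ) [NeZero N], N₀ ≤ N →
      (∃! μ : Measure (ShiftedIDLA.Cluster N), ShiftedIDLA.IsStationary N μ) ∧
      ∀ μ : Measure (ShiftedIDLA.Cluster N), ShiftedIDLA.IsStationary N μ →
        μ {A | (N : ℤ) ^ 8 < ShiftedIDLA.height A} ≤
          ENNReal.ofReal (2 * Real.exp (-(N : ℝ) / 2)) := by
  refine ⟨8, fun N _ hN => ⟨?_, fun μ hμ => ShiftedIDLA.measure_height_gt_le hN hμ⟩⟩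
  obtain ⟨μ, hμ⟩ := ShiftedIDLA.exists_isStationary (N := N) (by omega)
  refine ⟨μ, hμ, fun ν hν => ?_⟩
  have := hμ.1
  have := hν.1
  exact ShiftedIDLA.eq_of_invariant
    (fun η _ hη h0 => ShiftedIDLA.eq_zero_of_flat hη h0) hν.2 hμ.2
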